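/- **Setting.** Let $\mathbb{B}=\{0,1\}$ and $\overline{\mathbb{Q}}=\mathbb{Q}\cup\{-\infty,+\infty\}$. A program has Boolean states $b\in\mathbb{B}^n$, numeric states $x\in\mathbb{Q}^m$, an initial state $(b^0,x^0)$ and a transition relation $\tau=\exists y\in\mathbb{Q}^E\,\exists p\in\mathbb{B}^d.\,T$. Here $T$ is a quantifier-free formula in negation normal form whose atoms are propositional literals in $b,b',p$ and linear constraints ($\le$, $<$, $=$) in $x,x',y$ with rational coefficients. Every disjunction containing linear constraints is tagged by the variables $p$: for each $\pi\in\mathbb{B}^d$, $T[\pi/p]$ is (after simplifying constants) a conjunction of a propositional formula in $b,b'$ and linear constraints, whose conjunction is written $T_\pi$. Let $A\in\mathbb{Q}^{\ell\times m}$. An abstract value is a function $\rho:\mathbb{B}^n\to\overline{\mathbb{Q}}^{\ell}$, ordered pointwise, with $\gamma(\rho)=\{(b,x): Ax\le\rho(b)\}$. It is an inductive invariant if $(b^0,x^0)\in\gamma(\rho)$ and $(b,x)\in\gamma(\rho)$, $(b,x,b',x')\models\tau$ imply $(b',x')\in\gamma(\rho)$. A strategy assigns to each row $i$ and each $b'\in\mathbb{B}^n$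 either $\bot$ or a pair $(\sigma(i,b'),\pi(i,b'))\in\mathbb{B}^n\times\mathbb{B}^d$. For each row $i$, $T_i$ is a slicing of $T$ (for instance $T$ itself): a formula encoded in the same way such that $\tau\wedge A_ix'\ge v$ and $(\exists y,p.\,T_i)\wedge A_ix'\ge v$ are equivalent with respect to $(b,x,b',v)$, $x'$ being projected out. **Original iteration.** Start with all strategy entries $\bot$ and $\rho_0(b^0)=Ax^0$, $\rho_0(b)=-\infty$ for $b\neq b^0$. At $\rho_k$, for each $(i,b')$ for which some $(b,x,x',y,p)$ satisfies $T\wedge Ax\le\rho_k(b)\wedge A_ix'>\rho_k(i,b')$, set the strategy at $(i,b')$ to the $(b,p)$ of some such solution; keep the other entries. If there is no such $(i,b')$ at all, return $\rho_k$. Otherwise let $\rho_{k+1}$ be the least $\rho\ge\rho_k$ with $\rho=\Psi(\rho)$, where $\Psi(\rho)(i,b')=\sup\{A_ix' : \exists x,y.\ T_{\pi(i,b')}\wedge Ax\le\rho(\sigma(i,b'))\}$; at entries $\bot$, $\Psi(\rho)(i,b')$ is $A_ix^0$ if $b'=b^0$ and $-\infty$ otherwise. **Iterate.** Same start, with $stable=false$;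 while $\neg stable$, run Improve and then, if $\neg stable$, compute the strategy value. *Improve:* set $stable:=true$. For each row $i$, start with $U:=\emptyset$. While there is a model $(b,x,b',x',p,y)$ of $b'\notin U\wedge Ax\le\rho(b)\wedge T_i\wedge A_ix'>\rho(i,b')$, choose any one; let $F$ be the set of all $(b,b',p)$ that satisfy this formula with the chosen $x,x',y$; set $stable:=false$. While $F\ne\emptyset$, choose any $(b_1,b_1',p_1)\in F$; let $G=\{b':(b_1,b',p_1)\in F\}$; set the strategy at $(i,b')$ to $(b_1,p_1)$ for all $b'\in G$; add $G$ to $U$; delete from $F$ all triples with $b'\in G$. *Strategy value:* let $Z$ be the least set that contains every $b\ne b^0$ having an entry $\bot$ and every $b'\neq b^0$ with some $\sigma(i,b')\in Z$. The new $\rho$ is $-\infty$ on $Z$. For $b\notin Z$ it is obtained from a linear program with a single unknown $v_{i,[b]_i}$ for each row $i$ and each class of $b_1\sim_i b_2\iff(\sigma,\pi)(i,b_1)=(\sigma,\pi)(i,b_2)$. Its constraints are, for all $b'\notin Z$ and $i$ with current $\rho(i,b')<+\infty$, with fresh $x,x',y$ for each row and class: $A_jx\le v_{j,[\sigma(i,b')]_j}$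 for all $j$, $A_ix'\ge v_{i,[b']_i}$, and the constraints of $(T_i)_{\pi(i,b')}$ with $<$ relaxed to $\le$; at an entry $\bot$ (which is then at $b^0$) the constraint is $v_{i,[b^0]_i}\le A_ix^0$. The new $\rho(i,b)$ is the supremum in $\overline{\mathbb{Q}}$ of $v_{i,[b]_i}$. **Theorem.** Every execution of Iterate, for all choices of models, terminates, after at most $$\sum_{j=0}^{\ell 2^n}2^{(n+d)j}$$ iterations of its main loop, the last (stable) one included; this is less than $2\cdot 2^{(n+d)\ell 2^n}$ whenever $n+d\ge1$. At most $2^{(n+d)\ell 2^n}$ of these iterations evaluate a strategy without $\bot$. The domain has a least inductive invariant $\rho^*$; every execution of Iterate returns $\rho^*$. Every execution of the original iteration also terminates and returns $\rho^*$, so the two results are equal. -/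

import Mathlib

namespace StratIter

/-! ### Bounds, states, strategies -/

/-- `ℚ ∪ {-∞, +∞}`. -/
abbrev QBar : Type := WithBot (WithTop ℚ)

/-- The embedding of `ℚ` into `ℚ ∪ {-∞, +∞}`. -/
def fin (q : ℚ) : QBar := ((q : WithTop ℚ) : WithBot (WithTop ℚ))

/-- Boolean states. -/
abbrev BState (n : ℕ) : Type := Fin n → Bool

/-- Numeric states. -/
abbrev NState (m : ℕ) : Type := Fin m → ℚ

/-- Path choices: values of the existentially quantified Booleans `p₁, …, p_d`. -/
abbrev Path (d : ℕ) : Type := Fin d → Bool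

/-- Abstract values `𝔹ⁿ → (ℚ ∪ {±∞})^ℓ`, with the pointwise order. -/
abbrev AbsVal (n l : ℕ) : Type := BState n → Fin l → QBar

/-- Strategies: each row and each arrival state gets either `none` (the value `⊥`) or a pair
`(σ, π)` of a departure state and a path choice. -/
abbrev Strategy (n d l : ℕ) : Type := Fin l → BState n → Option (BState n × Path d)

/-! ### Transition formulas -/

/-- The three comparison signs. -/
inductive Cmp : Type
  | le
  | lt
  | eq

/-- The meaning of a comparison sign. -/
def Cmp.Holds : Cmp → ℚ → ℚ → Prop
  | .le, u, v => u ≤ v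
  | .lt, u, v => u < v
  | .eq, u, v => u = v

/-- The non-strict version of a comparison sign. -/
def Cmp.relax : Cmp → Cmp
  | .le => .le
  | .lt => .le
  | .eq => .eq

/-- A linear atom `∑ αᵢ xᵢ + ∑ αᵢ' xᵢ' + ∑ βᵢ yᵢ ⋈ c`. -/
structure LinAtom (m E : ℕ) : Type where
  cur : Fin m → ℚ
  nxt : Fin m → ℚ
  aux : Fin E → ℚ
  cmp : Cmp
  const : ℚ

/-- Satisfaction of a linear atom. -/
def LinAtom.Holds {m E : ℕ} (a : LinAtom m E) (x x' : NState m) (y : Fin E → ℚ) : Prop :=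
  a.cmp.Holds (∑ i, a.cur i * x i + ∑ i, a.nxt i * x' i + ∑ i, a.aux i * y i) a.const

/-- The non-strict version of a linear atom. -/
def LinAtom.relax {m E : ℕ} (a : LinAtom m E) : LinAtom m E :=
  { a with cmp := a.cmp.relax }

/-- Quantifier-free formulas in negation normal form.  The literal `cur i v` says `bᵢ = v`,
`nxt i v` says `bᵢ' = v` and `path j v` says `pⱼ = v`; negation occurs only as `v = false`. -/
inductive Formula (n m d E : ℕ) : Type
  | tru : Formula n m d E
  | fls : Formula n m d E
  | cur (i : Fin n) (v : Bool) : Formula n m d E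
  | nxt (i : Fin n) (v : Bool) : Formula n m d E
  | path (j : Fin d) (v : Bool) : Formula n m d E
  | lin (a : LinAtom m E) : Formula n m d E
  | and (φ ψ : Formula n m d E) : Formula n m d E
  | or (φ ψ : Formula n m d E) : Formula n m d E

namespace Formula

variable {n m d E : ℕ}

/-- Satisfaction: `(b, x, b', x', p, y) ⊨ φ`. -/
def Holds (b : BState n) (x : NState m) (b' : BState n) (x' : NState m) (p : Path d)
    (y : Fin E → ℚ) : Formula n m d E → Prop
  | tru => True
  | fls => False
  | cur i v => b i = v
  | nxt i v => b' i = v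
  | path j v => p j = v
  | lin a => a.Holds x x' y
  | and φ ψ => φ.Holds b x b' x' p y ∧ ψ.Holds b x b' x' p y
  | or φ ψ => φ.Holds b x b' x' p y ∨ ψ.Holds b x b' x' p y

/-- Conjunction, simplified when one side is a constant. -/
def mkAnd : Formula n m d E → Formula n m d E → Formula n m d E
  | fls, _ => fls
  | _, fls => fls
  | tru, ψ => ψ
  | φ, tru => φ
  | φ, ψ => and φ ψ

/-- Disjunction, simplified when one side is a constant. -/
def mkOr : Formula n m d E → Formula n m d E → Formula n m d E
  | tru, _ => tru
  | _, tru => tru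
  | fls, ψ => ψ
  | φ, fls => φ
  | φ, ψ => or φ ψ

/-- `T[π/p]`: the path literals are replaced by their truth values and the resulting constants
are simplified away. -/
def subst (p : Path d) : Formula n m d E → Formula n m d E
  | path j v => if p j = v then tru else fls
  | and φ ψ => mkAnd (φ.subst p) (ψ.subst p)
  | or φ ψ => mkOr (φ.subst p) (ψ.subst p)
  | φ => φ

/-- No linear atom occurs. -/
def IsProp : Formula n m d E → Prop
  | lin _ => False
  | and φ ψ => φ.IsProp ∧ ψ.IsProp
  | or φ ψ => φ.IsProp ∧ ψ.IsProp
  | _ => True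

/-- The formula is a conjunction of linear atoms and propositional formulas. -/
def IsConj : Formula n m d E → Prop
  | and φ ψ => φ.IsConj ∧ ψ.IsConj
  | or φ ψ => φ.IsProp ∧ ψ.IsProp
  | _ => True

/-- The linear atoms of a formula. -/
def atoms : Formula n m d E → List (LinAtom m E)
  | lin a => [a]
  | and φ ψ => φ.atoms ++ ψ.atoms
  | or φ ψ => φ.atoms ++ ψ.atoms
  | _ => []

/-- Every disjunction that contains linear atoms is tagged by path variables: once these are
fixed, what remains is a conjunction of linear atoms and a propositional formula. -/
def PathEncoded (φ : Formula n m d E) : Prop := ∀ p : Path d, (φ.subst p).IsConj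

/-- `T_π(x, x', y)`: the conjunction of the linear atoms of `T[π/p]`. -/
def PathHolds (φ : Formula n m d E) (p : Path d) (x x' : NState m) (y : Fin E → ℚ) : Prop :=
  ∀ a ∈ (φ.subst p).atoms, a.Holds x x' y

/-- The same conjunction with every `<` replaced by `≤`, as it enters a linear program. -/
def PathHoldsRelaxed (φ : Formula n m d E) (p : Path d) (x x' : NState m) (y : Fin E → ℚ) :
    Prop :=
  ∀ a ∈ (φ.subst p).atoms, a.relax.Holds x x' y

/-- The transition relation `τ = ∃ y ∈ ℚ^E, ∃ p ∈ 𝔹^d, T`. -/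
def Trans (φ : Formula n m d E) (b : BState n) (x : NState m) (b' : BState n)
    (x' : NState m) : Prop :=
  ∃ (y : Fin E → ℚ) (p : Path d), φ.Holds b x b' x' p y

end Formula

/-- A program: an initial state and the matrix `T` of its transition relation. -/
structure Program (n m d E : ℕ) : Type where
  initB : BState n
  initX : NState m
  T : Formula n m d E
  encoded : T.PathEncoded

/-! ### The template domain and inductive invariants -/

/-- The value `A_i x` of a template row. -/
def row {m l : ℕ} (A : Matrix (Fin l) (Fin m) ℚ) (i : Fin l) (x : NState m) : ℚ :=
  ∑ k, A i k * x k

/-- `A x ≤ c`, coordinatewise. -/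
def Sat {m l : ℕ} (A : Matrix (Fin l) (Fin m) ℚ) (x : NState m) (c : Fin l → QBar) : Prop :=
  ∀ i, fin (row A i x) ≤ c i

/-- The concretization `γ(ρ)`. -/
def gamma {n m l : ℕ} (A : Matrix (Fin l) (Fin m) ℚ) (ρ : AbsVal n l) :
    Set (BState n × NState m) :=
  {s | Sat A s.2 (ρ s.1)}

/-- Inductive invariants: they contain the initial state and are stable by transitions. -/
def IsInductive {n m d E l : ℕ} (P : Program n m d E) (A : Matrix (Fin l) (Fin m) ℚ)
    (ρ : AbsVal n l) : Prop :=
  (P.initB, P.initX) ∈ gamma A ρ ∧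
    ∀ b x b' x', (b, x) ∈ gamma A ρ → P.T.Trans b x b' x' → (b', x') ∈ gamma A ρ

/-- The initial abstract value: `A x⁰` at `b⁰`, and `-∞` elsewhere. -/
noncomputable def initVal {n m d E l : ℕ} (P : Program n m d E)
    (A : Matrix (Fin l) (Fin m) ℚ) : AbsVal n l :=
  fun b i => if b = P.initB then fin (row A i P.initX) else ⊥

/-- The strategy that is `⊥` everywhere. -/
def botStrategy (n d l : ℕ) : Strategy n d l := fun _ _ => none

/-- The tuple is a model of `A x ≤ ρ(b) ∧ φ ∧ A_i x' > ρ(i, b')`: a transition that starts inside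
the invariant described by `ρ` and violates row `i` of it on arrival. -/
def Violates {n m d E l : ℕ} (A : Matrix (Fin l) (Fin m) ℚ) (φ : Formula n m d E)
    (ρ : AbsVal n l) (i : Fin l) (b : BState n) (x : NState m) (b' : BState n) (x' : NState m)
    (p : Path d) (y : Fin E → ℚ) : Prop :=
  Sat A x (ρ b) ∧ φ.Holds b x b' x' p y ∧ ρ b' i < fin (row A i x')

/-! ### The original max-strategy iteration -/

/-- The set whose supremum is `Ψ_π(ρ)(i', b')`.  Where the strategy is `⊥`, only the initial state
contributes. -/
def psiSet {n m d E l : ℕ} (P : Program n m d E) (A : Matrix (Fin l) (Fin m) ℚ)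
    (S : Strategy n d l) (ρ : AbsVal n l) (i : Fin l) (b' : BState n) : Set QBar :=
  match S i b' with
  | none => {q | b' = P.initB ∧ q = fin (row A i P.initX)}
  | some (b, p) =>
      {q | ∃ x x' y, P.T.PathHolds p x x' y ∧ Sat A x (ρ b) ∧ q = fin (row A i x')}

/-- `Ψ_π(ρ) = ρ`. -/
def IsPsiFixed {n m d E l : ℕ} (P : Program n m d E) (A : Matrix (Fin l) (Fin m) ℚ)
    (S : Strategy n d l) (ρ : AbsVal n l) : Prop :=
  ∀ b' i, IsLUB (psiSet P A S ρ i b') (ρ b' i)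

/-- `ρ' = μ_{≥ ρ} Ψ_π`: the least fixed point of `Ψ_π` above `ρ`. -/
def IsStrategyValue {n m d E l : ℕ} (P : Program n m d E) (A : Matrix (Fin l) (Fin m) ℚ)
    (S : Strategy n d l) (ρ ρ' : AbsVal n l) : Prop :=
  IsLeast {η | ρ ≤ η ∧ IsPsiFixed P A S η} ρ'

/-- `S'` is an improvement of `S` at `ρ`: wherever some model of the violation formula exists, `S'`
takes the departure state and path choice of such a model; elsewhere it agrees with `S`. -/
def IsImprovement {n m d E l : ℕ} (P : Program n m d E) (A : Matrix (Fin l) (Fin m) ℚ)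
    (ρ : AbsVal n l) (S S' : Strategy n d l) : Prop :=
  ∀ i b',
    (∃ b x x' p y, Violates A P.T ρ i b x b' x' p y ∧ S' i b' = some (b, p)) ∨
    ((¬ ∃ b x x' p y, Violates A P.T ρ i b x b' x' p y) ∧ S' i b' = S i b')

/-- Some row is violated, so that the strategy has to be updated. -/
def HasViolation {n m d E l : ℕ} (P : Program n m d E) (A : Matrix (Fin l) (Fin m) ℚ)
    (ρ : AbsVal n l) : Prop :=
  ∃ i b x b' x' p y, Violates A P.T ρ i b x b' x' p y

/-- Configurations of the original algorithm. -/
inductive OrigConf (n d l : ℕ) : Type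
  | run (S : Strategy n d l) (ρ : AbsVal n l) : OrigConf n d l
  | halt (ρ : AbsVal n l) : OrigConf n d l

/-- One iteration of the original algorithm. -/
inductive OrigStep {n m d E l : ℕ} (P : Program n m d E) (A : Matrix (Fin l) (Fin m) ℚ) :
    OrigConf n d l → OrigConf n d l → Prop
  | exit (S : Strategy n d l) (ρ : AbsVal n l) (h : ¬ HasViolation P A ρ) :
      OrigStep P A (.run S ρ) (.halt ρ)
  | improve (S S' : Strategy n d l) (ρ ρ' : AbsVal n l) (h : HasViolation P A ρ)
      (hS : IsImprovement P A ρ S S') (hρ : IsStrategyValue P A S' ρ ρ') :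
      OrigStep P A (.run S ρ) (.run S' ρ')

/-- The initial configuration of the original algorithm. -/
noncomputable def origInit {n m d E l : ℕ} (P : Program n m d E)
    (A : Matrix (Fin l) (Fin m) ℚ) : OrigConf n d l :=
  .run (botStrategy n d l) (initVal P A)

/-! ### Strategy values with one unknown per equivalence class -/

/-- `ψ` is a slicing of `T` with respect to row `i` (for instance `T` itself): it is encoded in the
same way, and `τ ∧ A_i x' ≥ v` and `τ_ψ ∧ A_i x' ≥ v` are equivalent with respect to
`b, x, b', v`. -/
def IsSlice {n m d E l : ℕ} (P : Program n m d E) (A : Matrix (Fin l) (Fin m) ℚ) (i : Fin l)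
    (ψ : Formula n m d E) : Prop :=
  ψ.PathEncoded ∧
    ∀ b x b' (v : ℚ),
      (∃ x', P.T.Trans b x b' x' ∧ v ≤ row A i x') ↔ (∃ x', ψ.Trans b x b' x' ∧ v ≤ row A i x')

/-- The set `Z` of abstractly unreachable Boolean states. -/
inductive Unreachable {n d l : ℕ} (b0 : BState n) (S : Strategy n d l) : BState n → Prop
  | base (i : Fin l) (b : BState n) (hb : b ≠ b0) (h : S i b = none) : Unreachable b0 S b
  | step (i : Fin l) (b' b : BState n) (p : Path d) (hb : b' ≠ b0) (h : S i b' = some (b, p))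
      (hZ : Unreachable b0 S b) : Unreachable b0 S b'

/-- The relation `∼_i`: equal departure states and equal path choices for row `i`. -/
def classSetoid {n d l : ℕ} (S : Strategy n d l) (i : Fin l) : Setoid (BState n) :=
  Setoid.ker (S i)

/-- The unknowns of the linear program: one for each row `i` and each class of `∼_i`. -/
abbrev Unknowns {n d l : ℕ} (S : Strategy n d l) : Type :=
  (i : Fin l) → Quotient (classSetoid S i) → ℚ

/-- The unknown that stands for `ρ(i, b)`. -/
def Unknowns.at {n d l : ℕ} {S : Strategy n d l} (v : Unknowns S) (i : Fin l) (b : BState n) : ℚ :=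
  v i (Quotient.mk (classSetoid S i) b)

/-- Feasibility in the linear program for the strategy `S` and the current value `ρ`.  The row `i`
and the class of `b'` have their own copies of `x, x', y`; the inequalities depend on `b'` through
its class only.  At the initial state, `⊥` stands for the initial constraint. -/
def Feasible {n m d E l : ℕ} (P : Program n m d E) (A : Matrix (Fin l) (Fin m) ℚ)
    (sl : Fin l → Formula n m d E) (S : Strategy n d l) (ρ : AbsVal n l) (v : Unknowns S) : Prop :=
  ∀ i b', ¬ Unreachable P.initB S b' → ρ b' i < ⊤ →
    match S i b' with
    | none => v.at i b' ≤ row A i P.initX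
    | some (b, p) =>
        ∃ x x' y, (∀ j, row A j x ≤ v.at j b) ∧ v.at i b' ≤ row A i x' ∧
          (sl i).PathHoldsRelaxed p x x' y

/-- `ρ'` is the result of the reduced strategy evaluation: `-∞` on `Z`, and elsewhere the optimal
value of the unknown of the class (`+∞` if the program is unbounded). -/
def IsReducedValue {n m d E l : ℕ} (P : Program n m d E) (A : Matrix (Fin l) (Fin m) ℚ)
    (sl : Fin l → Formula n m d E) (S : Strategy n d l) (ρ ρ' : AbsVal n l) : Prop :=
  ∀ b i,
    (Unreachable P.initB S b → ρ' b i = ⊥) ∧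
    (¬ Unreachable P.initB S b →
      IsLUB {q | ∃ v : Unknowns S, Feasible P A sl S ρ v ∧ q = fin (v.at i b)} (ρ' b i))

/-! ### The algorithm Iterate -/

/-- Control points of Iterate, with the variables that are live there. -/
inductive Conf (n d l : ℕ) : Type
  /-- the test of the main loop -/
  | head (S : Strategy n d l) (ρ : AbsVal n l) (stable : Bool) : Conf n d l
  /-- in Improve, row `i`: the test of the outer `while` loop (`i = l`: the `for` loop is over) -/
  | outer (S : Strategy n d l) (ρ : AbsVal n l) (stable : Bool) (i : ℕ) (U : Set (BState n)) :
      Conf n d l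
  /-- in Improve, row `i`: the test of the inner `while` loop; `F` is the set of models
  `(b, b', p)` of the current propositional formula -/
  | inner (S : Strategy n d l) (ρ : AbsVal n l) (stable : Bool) (i : ℕ) (U : Set (BState n))
      (F : Set (BState n × BState n × Path d)) : Conf n d l
  /-- before the computation of the strategy value -/
  | eval (S : Strategy n d l) (ρ : AbsVal n l) : Conf n d l
  /-- termination with the abstract value `ρ` -/
  | halt (ρ : AbsVal n l) : Conf n d l

/-- `F`: what remains of the violation formula, conjoined with `¬ U`, once the numeric variables
have been replaced by their values in a model. -/
def generalize {n m d E l : ℕ} (A : Matrix (Fin l) (Fin m) ℚ) (φ : Formula n m d E)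
    (ρ : AbsVal n l) (i : Fin l) (U : Set (BState n)) (x x' : NState m) (y : Fin E → ℚ) :
    Set (BState n × BState n × Path d) :=
  {t | Violates A φ ρ i t.1 x t.2.1 x' t.2.2 y ∧ t.2.1 ∉ U}

/-- `G = F[b₁/b, p₁/p]`, as a set of arrival states. -/
def slab {n d : ℕ} (F : Set (BState n × BState n × Path d)) (b : BState n) (p : Path d) :
    Set (BState n) :=
  {b' | (b, b', p) ∈ F}

open Classical in
/-- `σ[i, G] := b; π[i, G] := p`. -/
noncomputable def update {n d l : ℕ} (S : Strategy n d l) (i : Fin l) (G : Set (BState n))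
    (b : BState n) (p : Path d) : Strategy n d l :=
  fun j b' => if j = i ∧ b' ∈ G then some (b, p) else S j b'

/-- The steps of Iterate, with Improve inlined. -/
inductive Step {n m d E l : ℕ} (P : Program n m d E) (A : Matrix (Fin l) (Fin m) ℚ)
    (sl : Fin l → Formula n m d E) : Conf n d l → Conf n d l → Prop
  | enter (S : Strategy n d l) (ρ : AbsVal n l) :
      Step P A sl (.head S ρ false) (.outer S ρ true 0 ∅)
  | exit (S : Strategy n d l) (ρ : AbsVal n l) : Step P A sl (.head S ρ true) (.halt ρ)
  | model (S : Strategy n d l) (ρ : AbsVal n l) (st : Bool) (i : ℕ) (hi : i < l)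
      (U : Set (BState n)) (b : BState n) (x : NState m) (b' : BState n) (x' : NState m)
      (p : Path d) (y : Fin E → ℚ) (h : Violates A (sl ⟨i, hi⟩) ρ ⟨i, hi⟩ b x b' x' p y)
      (hU : b' ∉ U) :
      Step P A sl (.outer S ρ st i U)
        (.inner S ρ false i U (generalize A (sl ⟨i, hi⟩) ρ ⟨i, hi⟩ U x x' y))
  | nextRow (S : Strategy n d l) (ρ : AbsVal n l) (st : Bool) (i : ℕ) (hi : i < l)
      (U : Set (BState n))
      (h : ¬ ∃ b x b' x' p y, Violates A (sl ⟨i, hi⟩) ρ ⟨i, hi⟩ b x b' x' p y ∧ b' ∉ U) :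
      Step P A sl (.outer S ρ st i U) (.outer S ρ st (i + 1) ∅)
  | assign (S : Strategy n d l) (ρ : AbsVal n l) (st : Bool) (i : ℕ) (hi : i < l)
      (U : Set (BState n)) (F : Set (BState n × BState n × Path d)) (b b' : BState n)
      (p : Path d) (h : (b, b', p) ∈ F) :
      Step P A sl (.inner S ρ st i U F)
        (.inner (update S ⟨i, hi⟩ (slab F b p) b p) ρ st i (U ∪ slab F b p)
          {t ∈ F | t.2.1 ∉ slab F b p})
  | innerEnd (S : Strategy n d l) (ρ : AbsVal n l) (st : Bool) (i : ℕ) (U : Set (BState n))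
      (F : Set (BState n × BState n × Path d)) (h : F = ∅) :
      Step P A sl (.inner S ρ st i U F) (.outer S ρ st i U)
  | isStable (S : Strategy n d l) (ρ : AbsVal n l) (U : Set (BState n)) :
      Step P A sl (.outer S ρ true l U) (.head S ρ true)
  | notStable (S : Strategy n d l) (ρ : AbsVal n l) (U : Set (BState n)) :
      Step P A sl (.outer S ρ false l U) (.eval S ρ)
  | value (S : Strategy n d l) (ρ ρ' : AbsVal n l) (h : IsReducedValue P A sl S ρ ρ') :
      Step P A sl (.eval S ρ) (.head S ρ' false)

/-- The initial configuration of Iterate. -/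
noncomputable def iterInit {n m d E l : ℕ} (P : Program n m d E)
    (A : Matrix (Fin l) (Fin m) ℚ) : Conf n d l :=
  .head (botStrategy n d l) (initVal P A) false

/-! ### Executions -/

/-- `c` is reached from `c₀` by an execution that performs `k` steps from configurations in `M`
(counted with repetition). -/
inductive Reaches {C : Type} (step : C → C → Prop) (M : Set C) (c₀ : C) : ℕ → C → Prop
  | refl : Reaches step M c₀ 0 c₀
  | count (k : ℕ) (c c' : C) (h : Reaches step M c₀ k c) (hc : step c c') (hM : c ∈ M) :
      Reaches step M c₀ (k + 1) c'
  | skip (k : ℕ) (c c' : C) (h : Reaches step M c₀ k c) (hc : step c c') (hM : c ∉ M) :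
      Reaches step M c₀ k c'

/-- Every execution from `c₀` is finite, and it can only stop in a configuration of `H`. -/
def Terminates {C : Type} (step : C → C → Prop) (H : Set C) (c₀ : C) : Prop :=
  Acc (fun c' c => step c c') c₀ ∧
    ∀ c, Relation.ReflTransGen step c₀ c → c ∈ H ∨ ∃ c', step c c'

/-- The points at which Iterate begins an iteration of its main loop. -/
def iterationStarts (n d l : ℕ) : Set (Conf n d l) :=
  {c | ∃ S ρ, c = .head S ρ false}

/-- The points at which Iterate evaluates a strategy that is nowhere `⊥`. -/
def fullEvaluations (n d l : ℕ) : Set (Conf n d l) :=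
  {c | ∃ S ρ, c = .eval S ρ ∧ ∀ i b, S i b ≠ none}

end StratIter

namespace StratIter

/-! ### Extended rationals -/

theorem qbar_cases (q : QBar) : q = ⊥ ∨ q = ⊤ ∨ ∃ r, q = fin r := by
  induction q using WithBot.recBotCoe with
  | bot => exact Or.inl rfl
  | coe a =>
    induction a using WithTop.recTopCoe with
    | top => exact Or.inr (Or.inl rfl)
    | coe a => exact Or.inr (Or.inr ⟨a, rfl⟩)

@[simp] theorem fin_le_fin {a b : ℚ} : fin a ≤ fin b ↔ a ≤ b := by
  simp only [fin, WithBot.coe_le_coe, WithTop.coe_le_coe]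

@[simp] theorem fin_lt_fin {a b : ℚ} : fin a < fin b ↔ a < b := by
  simp only [fin, WithBot.coe_lt_coe, WithTop.coe_lt_coe]

@[simp] theorem bot_lt_fin (a : ℚ) : ⊥ < fin a := WithBot.bot_lt_coe _

@[simp] theorem fin_lt_top (a : ℚ) : fin a < ⊤ :=
  WithBot.coe_lt_coe.2 (WithTop.coe_lt_top a)

theorem not_fin_le_bot (a : ℚ) : ¬ fin a ≤ ⊥ := not_le.2 (bot_lt_fin a)

theorem exists_fin_of_le_of_lt {q : QBar} {a : ℚ} (h : fin a ≤ q) (h' : q < ⊤) :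
    ∃ r, q = fin r := by
  rcases qbar_cases q with rfl | rfl | h''
  · exact absurd h (not_fin_le_bot a)
  · exact absurd h' (lt_irrefl _)
  · exact h''

theorem le_of_forall_fin_le {a b : QBar} (h : ∀ q, fin q ≤ a → fin q ≤ b) : a ≤ b := by
  rcases qbar_cases a with rfl | rfl | ⟨r, rfl⟩
  · exact bot_le
  · rcases qbar_cases b with rfl | rfl | ⟨s, rfl⟩
    · exact absurd (h 0 le_top) (not_fin_le_bot _)
    · exact le_rfl
    · have := fin_le_fin.1 (h (s + 1) le_top)
      linarith
  · exact h r le_rfl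

/-- A convex combination of two rationals below `q` is below `q`. -/
theorem fin_convex_le {q : QBar} {a b s t : ℚ} (hs : 0 ≤ s) (ht : 0 ≤ t) (hst : s + t = 1)
    (ha : fin a ≤ q) (hb : fin b ≤ q) : fin (s * a + t * b) ≤ q := by
  rcases qbar_cases q with rfl | rfl | ⟨r, rfl⟩
  · exact absurd ha (not_fin_le_bot _)
  · exact le_top
  · rw [fin_le_fin] at *
    calc s * a + t * b ≤ s * r + t * r := by gcongr
      _ = r := by rw [← add_mul, hst, one_mul]

/-- Truncation of an extended rational to a rational. -/
def trunc (N : ℚ) : QBar → ℚ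
  | ⊥ => -N
  | ((⊤ : WithTop ℚ) : QBar) => N
  | (((q : ℚ) : WithTop ℚ) : QBar) => q

@[simp] theorem trunc_bot (N : ℚ) : trunc N ⊥ = -N := rfl
@[simp] theorem trunc_top (N : ℚ) : trunc N ⊤ = N := rfl
@[simp] theorem trunc_fin (N q : ℚ) : trunc N (fin q) = q := rfl

open Filter

/-- Truncation turns an abstract value into a rational point that can be interpolated. The
statements are eventual in `N` so that finitely many of them can be met by one level. -/
theorem eventually_le_trunc {r : ℚ} {q : QBar} (h : fin r ≤ q) :
    ∀ᶠ N in atTop, r ≤ trunc N q := by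
  rcases qbar_cases q with rfl | rfl | ⟨s, rfl⟩
  · exact absurd h (not_fin_le_bot _)
  · exact eventually_ge_atTop r
  · exact Eventually.of_forall fun _ => fin_le_fin.1 h

theorem eventually_trunc_lt {r : ℚ} {q : QBar} (h : q < fin r) :
    ∀ᶠ N in atTop, trunc N q < r := by
  rcases qbar_cases q with rfl | rfl | ⟨s, rfl⟩
  · filter_upwards [eventually_gt_atTop (-r)] with N hN
    rw [trunc_bot]
    linarith
  · exact absurd h (not_lt.2 le_top)
  · exact Eventually.of_forall fun _ => fin_lt_fin.1 h

/-- The value `⊥` has to be excluded on the right: the truncation `-N` of `⊥` is never below `⊥`. -/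
theorem eventually_fin_trunc_le {q q' : QBar} (h : q ≤ q') (h' : q' ≠ ⊥) :
    ∀ᶠ N in atTop, fin (trunc N q) ≤ q' := by
  rcases qbar_cases q' with rfl | rfl | ⟨r, rfl⟩
  · exact absurd rfl h'
  · exact Eventually.of_forall fun _ => le_top
  · rcases h.lt_or_eq with h | rfl
    · filter_upwards [eventually_trunc_lt h] with N hN using fin_le_fin.2 hN.le
    · exact Eventually.of_forall fun _ => le_rfl

/-! ### Rows and atoms are linear -/

section Linear
variable {n m d E l : ℕ}

theorem row_comb (A : Matrix (Fin l) (Fin m) ℚ) (i : Fin l) (x z : NState m) (s t : ℚ) :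
    row A i (s • x + t • z) = s * row A i x + t * row A i z := by
  simp only [row, Pi.add_apply, Pi.smul_apply, smul_eq_mul, Finset.mul_sum,
    ← Finset.sum_add_distrib]
  exact Finset.sum_congr rfl fun _ _ => by ring

/-- The left-hand side of a linear atom. -/
def LinAtom.lhs (a : LinAtom m E) (x x' : NState m) (y : Fin E → ℚ) : ℚ :=
  ∑ i, a.cur i * x i + ∑ i, a.nxt i * x' i + ∑ i, a.aux i * y i

theorem sum_comb {k : ℕ} (c x z : Fin k → ℚ) (s t : ℚ) :
    ∑ i, c i * (s • x + t • z) i = s * ∑ i, c i * x i + t * ∑ i, c i * z i := by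
  simp only [Pi.add_apply, Pi.smul_apply, smul_eq_mul, Finset.mul_sum,
    ← Finset.sum_add_distrib]
  exact Finset.sum_congr rfl fun _ _ => by ring

theorem LinAtom.lhs_comb (a : LinAtom m E) (x x' z z' : NState m) (y v : Fin E → ℚ) (s t : ℚ) :
    a.lhs (s • x + t • z) (s • x' + t • z') (s • y + t • v) =
      s * a.lhs x x' y + t * a.lhs z z' v := by
  simp only [LinAtom.lhs, sum_comb]
  ring

theorem Cmp.Holds.to_relax {c : Cmp} {u k : ℚ} (h : c.Holds u k) : c.relax.Holds u k := by
  cases c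
  · exact h
  · exact le_of_lt h
  · exact h

theorem Cmp.relax_comb {c : Cmp} {u v k s t : ℚ} (hs : 0 ≤ s) (ht : 0 ≤ t) (hst : s + t = 1)
    (h : c.relax.Holds u k) (h' : c.relax.Holds v k) : c.relax.Holds (s * u + t * v) k := by
  have hk : s * k + t * k = k := by rw [← add_mul, hst, one_mul]
  cases c
  · exact (add_le_add (mul_le_mul_of_nonneg_left h hs) (mul_le_mul_of_nonneg_left h' ht)).trans_eq
      hk
  · exact (add_le_add (mul_le_mul_of_nonneg_left h hs) (mul_le_mul_of_nonneg_left h' ht)).trans_eq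
      hk
  · change u = k at h
    change v = k at h'
    rw [h, h']
    exact hk

theorem Cmp.strict_comb {c : Cmp} {u v k s t : ℚ} (hs : 0 < s) (ht : 0 ≤ t) (hst : s + t = 1)
    (h : c.Holds u k) (h' : c.relax.Holds v k) : c.Holds (s * u + t * v) k := by
  cases c with
  | lt =>
    have hk : s * k + t * k = k := by rw [← add_mul, hst, one_mul]
    exact (add_lt_add_of_lt_of_le (mul_lt_mul_of_pos_left h hs)
      (mul_le_mul_of_nonneg_left h' ht)).trans_eq hk
  | le => exact Cmp.relax_comb (c := .le) hs.le ht hst h h'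
  | eq => exact Cmp.relax_comb (c := .eq) hs.le ht hst h h'

theorem LinAtom.Holds.to_relax {a : LinAtom m E} {x x' : NState m} {y : Fin E → ℚ}
    (h : a.Holds x x' y) : a.relax.Holds x x' y := Cmp.Holds.to_relax h

theorem LinAtom.relax_comb {a : LinAtom m E} {x x' z z' : NState m} {y v : Fin E → ℚ} {s t : ℚ}
    (hs : 0 ≤ s) (ht : 0 ≤ t) (hst : s + t = 1) (h : a.relax.Holds x x' y)
    (h' : a.relax.Holds z z' v) :
    a.relax.Holds (s • x + t • z) (s • x' + t • z') (s • y + t • v) := by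
  change a.cmp.relax.Holds (a.lhs _ _ _) a.const
  rw [a.lhs_comb]
  exact Cmp.relax_comb hs ht hst h h'

/-- Mixing in a positive part of a strict solution makes a relaxed solution strict. -/
theorem LinAtom.strict_comb {a : LinAtom m E} {x x' z z' : NState m} {y v : Fin E → ℚ} {s t : ℚ}
    (hs : 0 < s) (ht : 0 ≤ t) (hst : s + t = 1) (h : a.Holds x x' y)
    (h' : a.relax.Holds z z' v) :
    a.Holds (s • x + t • z) (s • x' + t • z') (s • y + t • v) := by
  change a.cmp.Holds (a.lhs _ _ _) a.const
  rw [a.lhs_comb]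
  exact Cmp.strict_comb hs ht hst h h'

theorem Sat.mono {A : Matrix (Fin l) (Fin m) ℚ} {x : NState m} {c c' : Fin l → QBar}
    (h : Sat A x c) (hc : c ≤ c') : Sat A x c' := fun i => (h i).trans (hc i)

theorem Sat.comb {A : Matrix (Fin l) (Fin m) ℚ} {x z : NState m} {c : Fin l → QBar} {s t : ℚ}
    (hs : 0 ≤ s) (ht : 0 ≤ t) (hst : s + t = 1) (h : Sat A x c) (h' : Sat A z c) :
    Sat A (s • x + t • z) c := fun i => by
  rw [row_comb]
  exact fin_convex_le hs ht hst (h i) (h' i)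

end Linear

/-! ### Path-encoded formulas -/

namespace Formula
variable {n m d E : ℕ}

theorem holds_mkAnd {b : BState n} {x : NState m} {b' : BState n} {x' : NState m} {p : Path d}
    {y : Fin E → ℚ} (φ ψ : Formula n m d E) :
    (mkAnd φ ψ).Holds b x b' x' p y ↔ φ.Holds b x b' x' p y ∧ ψ.Holds b x b' x' p y := by
  cases φ <;> cases ψ <;> simp [mkAnd, Holds]

theorem holds_mkOr {b : BState n} {x : NState m} {b' : BState n} {x' : NState m} {p : Path d}
    {y : Fin E → ℚ} (φ ψ : Formula n m d E) :
    (mkOr φ ψ).Holds b x b' x' p y ↔ φ.Holds b x b' x' p y ∨ ψ.Holds b x b' x' p y := by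
  cases φ <;> cases ψ <;> simp [mkOr, Holds]

theorem holds_subst {b : BState n} {x : NState m} {b' : BState n} {x' : NState m} {p : Path d}
    {y : Fin E → ℚ} (φ : Formula n m d E) :
    (φ.subst p).Holds b x b' x' p y ↔ φ.Holds b x b' x' p y := by
  induction φ with
  | path j v => by_cases h : p j = v <;> simp [subst, h, Holds]
  | and φ ψ h h' => rw [subst, holds_mkAnd, h, h', Holds]
  | or φ ψ h h' => rw [subst, holds_mkOr, h, h', Holds]
  | _ => rfl

theorem IsProp.holds_congr {b : BState n} {x z : NState m} {b' : BState n} {x' z' : NState m}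
    {p : Path d} {y v : Fin E → ℚ} {φ : Formula n m d E} (h : φ.IsProp)
    (hφ : φ.Holds b x b' x' p y) : φ.Holds b z b' z' p v := by
  induction φ with
  | lin a => exact h.elim
  | and φ ψ ih ih' => exact ⟨ih h.1 hφ.1, ih' h.2 hφ.2⟩
  | or φ ψ ih ih' => exact hφ.imp (ih h.1) (ih' h.2)
  | _ => exact hφ

theorem IsProp.atoms_eq_nil {φ : Formula n m d E} (h : φ.IsProp) : φ.atoms = [] := by
  induction φ with
  | lin a => exact h.elim
  | and φ ψ ih ih' => simp [atoms, ih h.1, ih' h.2]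
  | or φ ψ ih ih' => simp [atoms, ih h.1, ih' h.2]
  | _ => rfl

theorem IsConj.atoms_hold {b : BState n} {x : NState m} {b' : BState n} {x' : NState m}
    {p : Path d} {y : Fin E → ℚ} {φ : Formula n m d E} (h : φ.IsConj)
    (hφ : φ.Holds b x b' x' p y) : ∀ a ∈ φ.atoms, a.Holds x x' y := by
  induction φ with
  | lin a =>
    intro a' ha'
    rw [List.mem_singleton.1 ha']
    exact hφ
  | and φ ψ ih ih' =>
    intro a ha
    exact (List.mem_append.1 ha).elim (ih h.1 hφ.1 a) (ih' h.2 hφ.2 a)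
  | or φ ψ ih ih' =>
    intro a ha
    simp [atoms, h.1.atoms_eq_nil, h.2.atoms_eq_nil] at ha
  | _ => exact fun a ha => absurd ha (List.not_mem_nil)

theorem IsConj.holds_of_atoms {b : BState n} {x z : NState m} {b' : BState n} {x' z' : NState m}
    {p : Path d} {y v : Fin E → ℚ} {φ : Formula n m d E} (h : φ.IsConj)
    (hφ : φ.Holds b x b' x' p y) (ha : ∀ a ∈ φ.atoms, a.Holds z z' v) :
    φ.Holds b z b' z' p v := by
  induction φ with
  | lin a => exact ha a (List.mem_singleton.2 rfl)
  | and φ ψ ih ih' =>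
    exact ⟨ih h.1 hφ.1 fun a h => ha a (List.mem_append_left _ h),
      ih' h.2 hφ.2 fun a h => ha a (List.mem_append_right _ h)⟩
  | or φ ψ ih ih' => exact IsProp.holds_congr (φ := .or φ ψ) h hφ
  | _ => exact hφ

theorem Holds.pathHolds {b : BState n} {x : NState m} {b' : BState n} {x' : NState m}
    {p : Path d} {y : Fin E → ℚ} {φ : Formula n m d E} (hφ : φ.Holds b x b' x' p y)
    (h : φ.PathEncoded) : φ.PathHolds p x x' y :=
  (h p).atoms_hold ((holds_subst φ).2 hφ)

/-- `T_π` forgets the propositional part of the formula. One known model with the same Booleans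
supplies that part, so every numeric solution along the path is a genuine transition. -/
theorem Holds.of_pathHolds {b : BState n} {x z : NState m} {b' : BState n} {x' z' : NState m}
    {p : Path d} {y v : Fin E → ℚ} {φ : Formula n m d E} (hφ : φ.Holds b x b' x' p y)
    (h : φ.PathEncoded) (hp : φ.PathHolds p z z' v) : φ.Holds b z b' z' p v :=
  (holds_subst φ).1 ((h p).holds_of_atoms ((holds_subst φ).2 hφ) hp)

theorem PathHolds.relaxed {φ : Formula n m d E} {p : Path d} {x x' : NState m} {y : Fin E → ℚ}
    (h : φ.PathHolds p x x' y) : φ.PathHoldsRelaxed p x x' y := fun a ha => (h a ha).to_relax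

end Formula

/-! ### Linear programs over the rationals -/

/-- Fourier–Motzkin elimination of one variable. -/
theorem exists_eliminate {J : Type} [Finite J] (a b : J → ℚ) :
    (∃ t, ∀ j, a j * t ≤ b j) ↔
      (∀ j, a j = 0 → 0 ≤ b j) ∧ ∀ j k, 0 < a j → a k < 0 → a j * b k - a k * b j ≥ 0 := by
  constructor
  · rintro ⟨t, ht⟩
    refine ⟨fun j hj => by simpa [hj] using ht j, fun j k hj hk => ?_⟩
    have h1 := mul_le_mul_of_nonneg_left (ht k) hj.le
    have h2 := mul_le_mul_of_nonneg_left (ht j) (neg_nonneg.2 hk.le)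
    linarith
  · rintro ⟨h0, h⟩
    cases nonempty_fintype J
    by_cases hp : ∃ j, 0 < a j
    · obtain ⟨j, hj, hmin⟩ := Finset.exists_min_image (Finset.univ.filter fun j => 0 < a j)
        (fun j => b j / a j) ⟨hp.choose, by simpa using hp.choose_spec⟩
      simp only [Finset.mem_filter, Finset.mem_univ, true_and] at hj hmin
      -- The least upper bound on `t`; the condition on pairs of opposite signs places it above
      -- every lower bound.
      refine ⟨b j / a j, fun k => ?_⟩
      rcases lt_trichotomy (a k) 0 with hk | hk | hk
      · have := h j k hj hk
        rw [mul_div_assoc', div_le_iff₀ hj]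
        linarith
      · simpa [hk] using h0 k hk
      · have := hmin k hk
        rwa [le_div_iff₀ hk, mul_comm] at this
    · push Not at hp
      by_cases hn : ∃ k, a k < 0
      · obtain ⟨j, hj, hmax⟩ := Finset.exists_max_image (Finset.univ.filter fun j => a j < 0)
          (fun j => b j / a j) ⟨hn.choose, by simpa using hn.choose_spec⟩
        simp only [Finset.mem_filter, Finset.mem_univ, true_and] at hj hmax
        refine ⟨b j / a j, fun k => ?_⟩
        rcases (hp k).lt_or_eq with hk | hk
        · have := hmax k hk
          rwa [div_le_iff_of_neg hk, mul_comm] at this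
        · simpa [hk] using h0 k hk
      · push Not at hn
        refine ⟨0, fun k => ?_⟩
        simpa using h0 k (le_antisymm (hp k) (hn k))

/-- The projection of a polyhedron to a line is described by finitely many inequalities. -/
theorem exists_projection (n : ℕ) : ∀ (J : Type) [Finite J] (a : J → Fin n → ℚ) (d c : J → ℚ),
    ∃ (K : Type) (_ : Finite K) (e g : K → ℚ), ∀ t,
      (∃ z : Fin n → ℚ, ∀ j, ∑ i, a j i * z i + d j * t ≤ c j) ↔ ∀ k, e k * t ≤ g k := by
  induction n with
  | zero =>
    intro J _ a d c
    exact ⟨J, inferInstance, d, c, fun t => by simp⟩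
  | succ n ih =>
    intro J _ a d c
    -- The rows left after elimination: those free of the first variable, and one positive
    -- combination for each pair of a row bounding it above and a row bounding it below.
    obtain ⟨K, hK, e, g, h⟩ := ih
      ({j : J // a j 0 = 0} ⊕ {q : J × J // 0 < a q.1 0 ∧ a q.2 0 < 0})
      (Sum.elim (fun j i => a j i.succ)
        fun q i => a q.1.1 0 * a q.1.2 i.succ - a q.1.2 0 * a q.1.1 i.succ)
      (Sum.elim (fun j => d j) fun q => a q.1.1 0 * d q.1.2 - a q.1.2 0 * d q.1.1)
      (Sum.elim (fun j => c j) fun q => a q.1.1 0 * c q.1.2 - a q.1.2 0 * c q.1.1)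
    refine ⟨K, hK, e, g, fun t => ?_⟩
    rw [← h t]
    have hz : (∃ z : Fin (n + 1) → ℚ, ∀ j, ∑ i, a j i * z i + d j * t ≤ c j) ↔
        ∃ z : Fin n → ℚ, ∃ s : ℚ, ∀ j,
          a j 0 * s ≤ c j - d j * t - ∑ i, a j i.succ * z i := by
      constructor
      · rintro ⟨z, hz⟩
        refine ⟨fun i => z i.succ, z 0, fun j => ?_⟩
        have := hz j
        rw [Fin.sum_univ_succ] at this
        linarith
      · rintro ⟨z, s, hz⟩
        refine ⟨Fin.cons s z, fun j => ?_⟩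
        have := hz j
        rw [Fin.sum_univ_succ]
        simp only [Fin.cons_zero, Fin.cons_succ]
        linarith
    rw [hz]
    refine exists_congr fun z => ?_
    rw [exists_eliminate]
    have hs : ∀ j k, ∑ i : Fin n, (a j 0 * a k i.succ - a k 0 * a j i.succ) * z i =
        a j 0 * ∑ i : Fin n, a k i.succ * z i - a k 0 * ∑ i : Fin n, a j i.succ * z i := by
      intro j k
      rw [Finset.mul_sum, Finset.mul_sum, ← Finset.sum_sub_distrib]
      exact Finset.sum_congr rfl fun _ _ => by ring
    constructor
    · rintro ⟨h0, h1⟩ (⟨j, hj⟩ | ⟨⟨j, k⟩, hj, hk⟩)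
      · have := h0 j hj
        simp only [Sum.elim_inl]
        linarith
      · have := h1 j k hj hk
        simp only [Sum.elim_inr, hs]
        linarith
    · intro h
      constructor
      · intro j hj
        have := h (.inl ⟨j, hj⟩)
        simp only [Sum.elim_inl] at this
        linarith
      · intro j k hj hk
        have := h (.inr ⟨(j, k), hj, hk⟩)
        simp only [Sum.elim_inr, hs] at this
        linarith

/-- A set cut out by finitely many non-strict linear inequalities. -/
def Polyhedral {V : Type} [AddCommGroup V] [Module ℚ V] (s : Set V) : Prop :=
  ∃ (J : Type) (_ : Finite J) (g : J → V →ₗ[ℚ] ℚ) (c : J → ℚ), s = {z | ∀ j, g j z ≤ c j}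

namespace Polyhedral
variable {V : Type} [AddCommGroup V] [Module ℚ V]

theorem halfspace {f : V → ℚ} (hf : IsLinearMap ℚ f) (c : ℚ) : Polyhedral {z | f z ≤ c} :=
  ⟨Unit, inferInstance, fun _ => hf.mk' f, fun _ => c, by ext z; simp⟩

theorem iInter {ι : Type} [Finite ι] {s : ι → Set V} (h : ∀ i, Polyhedral (s i)) :
    Polyhedral (⋂ i, s i) := by
  choose J hJ g c hs using h
  refine ⟨Σ i, J i, inferInstance, fun q => g q.1 q.2, fun q => c q.1 q.2, ?_⟩
  ext z
  simp [hs, Sigma.forall]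

theorem inter {s t : Set V} (hs : Polyhedral s) (ht : Polyhedral t) : Polyhedral (s ∩ t) := by
  rw [Set.inter_eq_iInter]
  exact iInter fun b => by cases b <;> assumption

theorem univ : Polyhedral (Set.univ : Set V) :=
  ⟨Empty, inferInstance, fun e => e.elim, fun e => e.elim, by ext; simp⟩

theorem hyperplane {f : V → ℚ} (hf : IsLinearMap ℚ f) (c : ℚ) : Polyhedral {z | f z = c} := by
  have h := (halfspace hf c).inter (halfspace (f := fun z => -f z) (-(hf.mk' f)).isLinear (-c))
  convert h using 1
  ext z
  simp [le_antisymm_iff]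

theorem forall_mem_list {α : Type} (L : List α) {s : α → Set V}
    (h : ∀ a, Polyhedral (s a)) : Polyhedral {z | ∀ a ∈ L, z ∈ s a} := by
  have := iInter (fun i : Fin L.length => h (L.get i))
  convert this using 1
  ext z
  simp [List.forall_mem_iff_getElem, Fin.forall_iff]

/-- A linear function on a nonempty polyhedron is unbounded or attains its maximum. -/
theorem unbounded_or_max [Module.Finite ℚ V] {s : Set V} (hs : Polyhedral s) (hne : s.Nonempty)
    {f : V → ℚ} (hf : IsLinearMap ℚ f) :
    (∀ M, ∃ z ∈ s, M ≤ f z) ∨ ∃ z ∈ s, ∀ z' ∈ s, f z' ≤ f z := by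
  obtain ⟨J, hJ, g, c, rfl⟩ := hs
  let B := Module.finBasis ℚ V
  let F := hf.mk' f
  have hsum : ∀ (h : V →ₗ[ℚ] ℚ) (z : Fin (Module.finrank ℚ V) → ℚ),
      h (∑ i, z i • B i) = ∑ i, h (B i) * z i := fun h z => by
    rw [map_sum]
    exact Finset.sum_congr rfl fun i _ => by rw [map_smul, smul_eq_mul, mul_comm]
  -- The two rows indexed by `Bool` encode `f z = t`, so that the projection is the set of values of
  -- `f` on the polyhedron.
  obtain ⟨K, hK, e, q, hproj⟩ := exists_projection (Module.finrank ℚ V) (J ⊕ Bool)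
    (Sum.elim (fun j i => g j (B i)) fun b i => bif b then F (B i) else -F (B i))
    (Sum.elim (fun _ => 0) fun b => bif b then -1 else 1)
    (Sum.elim c fun _ => 0)
  have key : ∀ t, (∃ z ∈ {z | ∀ j, g j z ≤ c j}, f z = t) ↔ ∀ k, e k * t ≤ q k := by
    intro t
    rw [← hproj t]
    have h2 : ∀ z : Fin (Module.finrank ℚ V) → ℚ, f (∑ i, z i • B i) = ∑ i, F (B i) * z i :=
      hsum F
    constructor
    · rintro ⟨z, hz, rfl⟩
      obtain ⟨w, rfl⟩ : ∃ w : Fin (Module.finrank ℚ V) → ℚ, ∑ i, w i • B i = z :=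
        ⟨fun i => B.repr z i, B.sum_repr z⟩
      refine ⟨w, ?_⟩
      rintro (j | _ | _)
      · have := hz j
        rw [hsum] at this
        simpa using this
      · simp [h2]
      · simp [h2]
    · rintro ⟨w, hw⟩
      refine ⟨∑ i, w i • B i, fun j => ?_, ?_⟩
      · have := hw (.inl j)
        rw [hsum]
        simpa using this
      · have h1 := hw (.inr true)
        have h3 := hw (.inr false)
        simp only [Sum.elim_inr, cond_true, cond_false, neg_mul, Finset.sum_neg_distrib] at h1 h3
        rw [h2]
        linarith
  obtain ⟨z0, hz0⟩ := hne
  have h0 := (key (f z0)).1 ⟨z0, hz0, rfl⟩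
  cases nonempty_fintype K
  by_cases hp : ∃ k, 0 < e k
  · right
    obtain ⟨j, hj, hmin⟩ := Finset.exists_min_image (Finset.univ.filter fun j => 0 < e j)
      (fun j => q j / e j) ⟨hp.choose, by simpa using hp.choose_spec⟩
    simp only [Finset.mem_filter, Finset.mem_univ, true_and] at hj hmin
    have hle : ∀ t, (∀ k, e k * t ≤ q k) → t ≤ q j / e j := fun t ht => by
      rw [le_div_iff₀ hj, mul_comm]
      exact ht j
    -- The least upper bound on the values is itself a value: it is at least `f z0`, and rows with
    -- `e k ≤ 0` stay true when `t` increases.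
    obtain ⟨z, hz, hfz⟩ := (key (q j / e j)).2 fun k => by
      rcases le_or_gt (e k) 0 with hk | hk
      · exact (mul_le_mul_of_nonpos_left (hle _ h0) hk).trans (h0 k)
      · have := hmin k hk
        rwa [le_div_iff₀ hk, mul_comm] at this
    exact ⟨z, hz, fun z' hz' => hfz ▸ hle _ ((key _).1 ⟨z', hz', rfl⟩)⟩
  · left
    push Not at hp
    intro M
    -- Without positive coefficients the set of values is closed upwards, and it contains `f z0`.
    obtain ⟨z, hz, hfz⟩ := (key (max M (f z0))).2 fun k =>
      (mul_le_mul_of_nonpos_left (le_max_right _ _) (hp k)).trans (h0 k)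
    exact ⟨z, hz, hfz ▸ le_max_left _ _⟩

end Polyhedral

section Evaluation
variable {n m d E l : ℕ}

/-! ### Values attained along a path -/

/-- Some relaxed solution on path `p`, departing from within the bounds `c`, has a value of at
least `r` in row `i` on arrival. -/
def Attain (A : Matrix (Fin l) (Fin m) ℚ) (φ : Formula n m d E) (p : Path d) (i : Fin l)
    (c : Fin l → QBar) (r : ℚ) : Prop :=
  ∃ x x' y, Sat A x c ∧ φ.PathHoldsRelaxed p x x' y ∧ r ≤ row A i x'

variable {A : Matrix (Fin l) (Fin m) ℚ}

theorem Attain.mono {φ : Formula n m d E} {p : Path d} {i : Fin l} {c c' : Fin l → QBar} {r r' : ℚ}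
    (h : Attain A φ p i c r) (hc : c ≤ c') (hr : r' ≤ r) : Attain A φ p i c' r' := by
  obtain ⟨x, x', y, hx, hp, hr'⟩ := h
  exact ⟨x, x', y, hx.mono hc, hp, hr.trans hr'⟩

/-- A vector of rational bounds, as extended rationals. -/
def finVal (w : BState n → Fin l → ℚ) (b : BState n) : Fin l → QBar := fun j => fin (w b j)

theorem sat_finVal {x : NState m} {w : BState n → Fin l → ℚ} {b : BState n} :
    Sat A x (finVal w b) ↔ ∀ j, row A j x ≤ w b j :=
  forall_congr' fun _ => fin_le_fin

theorem finVal_mono {w w' : BState n → Fin l → ℚ} (h : w ≤ w') (b : BState n) :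
    finVal w b ≤ finVal w' b := fun j => fin_le_fin.2 (h b j)

theorem Attain.comb {φ : Formula n m d E} {p : Path d} {i : Fin l} {w w' : BState n → Fin l → ℚ}
    {b : BState n} {r r' s t : ℚ} (hs : 0 ≤ s) (ht : 0 ≤ t) (hst : s + t = 1)
    (h : Attain A φ p i (finVal w b) r) (h' : Attain A φ p i (finVal w' b) r') :
    Attain A φ p i (finVal (s • w + t • w') b) (s * r + t * r') := by
  obtain ⟨x, x', y, hx, hp, hr⟩ := h
  obtain ⟨z, z', v, hz, hp', hr'⟩ := h'
  rw [sat_finVal] at hx hz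
  refine ⟨s • x + t • z, s • x' + t • z', s • y + t • v, sat_finVal.2 fun j => ?_,
    fun a ha => LinAtom.relax_comb hs ht hst (hp a ha) (hp' a ha), ?_⟩
  · rw [row_comb]
    exact add_le_add (mul_le_mul_of_nonneg_left (hx j) hs) (mul_le_mul_of_nonneg_left (hz j) ht)
  · rw [row_comb]
    exact add_le_add (mul_le_mul_of_nonneg_left hr hs) (mul_le_mul_of_nonneg_left hr' ht)

theorem Violates.attain {φ : Formula n m d E} (hφ : φ.PathEncoded) {ρ : AbsVal n l} {i : Fin l}
    {b : BState n} {x : NState m} {b' : BState n} {x' : NState m} {p : Path d} {y : Fin E → ℚ}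
    (h : Violates A φ ρ i b x b' x' p y) : Attain A φ p i (ρ b) (row A i x') :=
  ⟨x, x', y, h.1, (h.2.1.pathHolds hφ).relaxed, le_rfl⟩

/-- Where a strict solution exists, the relaxed solutions have the same bounds as the strict ones. -/
theorem Attain.le_of_strict {φ : Formula n m d E} {p : Path d} {i : Fin l} {c : Fin l → QBar}
    {r : ℚ} (h : Attain A φ p i c r) {z z' : NState m} {v : Fin E → ℚ} (hz : Sat A z c)
    (hq : φ.PathHolds p z z' v) {q : QBar}
    (hη : ∀ x x' y, Sat A x c → φ.PathHolds p x x' y → fin (row A i x') ≤ q) : fin r ≤ q := by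
  obtain ⟨x, x', y, hx, hp, hr⟩ := h
  refine (fin_le_fin.2 hr).trans ?_
  have hb := hη z z' v hz hq
  rcases qbar_cases q with rfl | rfl | ⟨e, rfl⟩
  · exact absurd hb (not_fin_le_bot _)
  · exact le_top
  rw [fin_le_fin] at hb ⊢
  by_contra! hlt
  set D := row A i x' - row A i z' with hD
  have hDpos : 0 < D := by linarith
  -- With this weight the strict solution lowers the value by `s * D`, half of the excess over `e`,
  -- so the strict mixture still exceeds `e`.
  let s := (row A i x' - e) / (2 * D)
  have hs : 0 < s := div_pos (by linarith) (by linarith)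
  have hsD : s * D = (row A i x' - e) / 2 := by
    simp only [s]
    field_simp
  have hs1 : s ≤ 1 := (div_le_one (by linarith)).2 (by linarith)
  have key := hη _ _ _ (Sat.comb hs.le (sub_nonneg.2 hs1) (by ring) hz hx)
    fun a ha => LinAtom.strict_comb hs (sub_nonneg.2 hs1) (by ring) (hq a ha) (hp a ha)
  rw [row_comb, fin_le_fin] at key
  have : s * row A i z' + (1 - s) * row A i x' = row A i x' - s * D := by
    rw [hD]
    ring
  linarith

/-! ### The linear program with one unknown per row and state -/

/-- Feasibility in the linear program with a separate unknown for each row and state, and with all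
constraints present. -/
def FullFeasible (P : Program n m d E) (A : Matrix (Fin l) (Fin m) ℚ)
    (sl : Fin l → Formula n m d E) (S : Strategy n d l) (w : BState n → Fin l → ℚ) : Prop :=
  ∀ b i, ¬ Unreachable P.initB S b →
    (S i b = none → w b i ≤ row A i P.initX) ∧
    ∀ σ p, S i b = some (σ, p) → Attain A (sl i) p i (finVal w σ) (w b i)

variable {P : Program n m d E} {sl : Fin l → Formula n m d E} {S : Strategy n d l}

/-- At each entry the larger of the two values keeps its own witness, since the bounds at departure
only increase. This is what allows several unknowns to be made large at once. -/
theorem FullFeasible.sup {w w' : BState n → Fin l → ℚ} (h : FullFeasible P A sl S w)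
    (h' : FullFeasible P A sl S w') : FullFeasible P A sl S (w ⊔ w') := by
  intro b i hb
  refine ⟨fun hn => sup_le ((h b i hb).1 hn) ((h' b i hb).1 hn), fun σ p hs => ?_⟩
  rcases le_total (w b i) (w' b i) with hle | hle
  · exact ((h' b i hb).2 σ p hs).mono (finVal_mono le_sup_right σ) (sup_le hle le_rfl)
  · exact ((h b i hb).2 σ p hs).mono (finVal_mono le_sup_left σ) (sup_le le_rfl hle)

/-- Take one feasible point per entry; the maximum of these finitely many points serves all entries,
`Q` being closed upwards. -/
theorem FullFeasible.exists_forall {Q : BState n → Fin l → ℚ → Prop}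
    (hQ : ∀ b i q q', q ≤ q' → Q b i q → Q b i q') (h0 : ∃ w, FullFeasible P A sl S w)
    (h : ∀ b i, ∃ w, FullFeasible P A sl S w ∧ Q b i (w b i)) :
    ∃ w, FullFeasible P A sl S w ∧ ∀ b i, Q b i (w b i) := by
  have key : ∀ s : Finset (BState n × Fin l),
      ∃ w, FullFeasible P A sl S w ∧ ∀ k ∈ s, Q k.1 k.2 (w k.1 k.2) := by
    intro s
    induction s using Finset.induction_on with
    | empty =>
      obtain ⟨w, hw⟩ := h0
      exact ⟨w, hw, by simp⟩
    | insert k s _ ih =>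
      obtain ⟨w, hw, hs⟩ := ih
      obtain ⟨w', hw', hk⟩ := h k.1 k.2
      refine ⟨w ⊔ w', hw.sup hw', fun k' hk' => ?_⟩
      rcases Finset.mem_insert.1 hk' with rfl | hk'
      · exact hQ _ _ _ _ le_sup_right hk
      · exact hQ _ _ _ _ le_sup_left (hs k' hk')
  obtain ⟨w, hw, hs⟩ := key Finset.univ
  exact ⟨w, hw, fun b i => hs (b, i) (Finset.mem_univ _)⟩

/-- Raising one unknown to a value attained by its own constraint keeps feasibility. -/
theorem FullFeasible.raise {w : BState n → Fin l → ℚ} (h : FullFeasible P A sl S w)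
    {b : BState n} {i : Fin l} {σ : BState n} {p : Path d} {r : ℚ} (hS : S i b = some (σ, p))
    (hr : Attain A (sl i) p i (finVal w σ) r) :
    ∃ w', FullFeasible P A sl S w' ∧ r ≤ w' b i := by
  classical
  let w' : BState n → Fin l → ℚ := fun b₁ i₁ => if b₁ = b ∧ i₁ = i then w b i ⊔ r else w b₁ i₁
  have hw : w ≤ w' := by
    intro b₁ i₁
    by_cases hk : b₁ = b ∧ i₁ = i
    · simp only [w', hk.1, hk.2]
      exact le_sup_left
    · simp only [w', if_neg hk]
      exact le_rfl
  refine ⟨w', fun b₁ i₁ hb₁ => ?_, by simp [w']⟩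
  by_cases hk : b₁ = b ∧ i₁ = i
  · obtain ⟨rfl, rfl⟩ := hk
    refine ⟨fun hn => by simp [hn] at hS, fun σ' p' hS' => ?_⟩
    rw [hS] at hS'
    cases hS'
    have hval : w' b₁ i₁ = w b₁ i₁ ⊔ r := by simp [w']
    rw [hval]
    rcases le_total (w b₁ i₁) r with hle | hle
    · exact hr.mono (finVal_mono hw _) (sup_le hle le_rfl)
    · exact ((h b₁ i₁ hb₁).2 _ _ hS).mono (finVal_mono hw _) (sup_le le_rfl hle)
  · have hval : w' b₁ i₁ = w b₁ i₁ := by simp only [w', if_neg hk]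
    rw [hval]
    exact ⟨(h b₁ i₁ hb₁).1, fun σ' p' hS' =>
      ((h b₁ i₁ hb₁).2 _ _ hS').mono (finVal_mono hw _) le_rfl⟩

theorem isLinearMap_of_comb {V : Type} [AddCommGroup V] [Module ℚ V] {f : V → ℚ}
    (h : ∀ (s t : ℚ) x z, f (s • x + t • z) = s * f x + t * f z) : IsLinearMap ℚ f :=
  ⟨fun x z => by simpa using h 1 1 x z, fun s x => by simpa using h s 0 x x⟩

/-- In each unknown the linear program is unbounded or attains its optimum. -/
theorem FullFeasible.unbounded_or_max (hne : ∃ w, FullFeasible P A sl S w) (b : BState n)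
    (i : Fin l) :
    (∀ M, ∃ w, FullFeasible P A sl S w ∧ M ≤ w b i) ∨
      ∃ w, FullFeasible P A sl S w ∧ ∀ w', FullFeasible P A sl S w' → w' b i ≤ w b i := by
  -- With a copy of `x, x', y` for each entry, the feasible points become the projection of a
  -- polyhedron to its first component.
  let V := (BState n → Fin l → ℚ) × (BState n → Fin l → NState m × NState m × (Fin E → ℚ))
  let s : Set V := {z | ∀ b i, ¬ Unreachable P.initB S b →
    (S i b = none → z.1 b i ≤ row A i P.initX) ∧
    ∀ σ p, S i b = some (σ, p) → (∀ j, row A j (z.2 b i).1 ≤ z.1 σ j) ∧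
      (sl i).PathHoldsRelaxed p (z.2 b i).1 (z.2 b i).2.1 (z.2 b i).2.2 ∧
      z.1 b i ≤ row A i (z.2 b i).2.1}
  have hs : Polyhedral s := by
    have hset : s = ⋂ b, ⋂ i, {z : V | ¬ Unreachable P.initB S b →
        (S i b = none → z.1 b i ≤ row A i P.initX) ∧
        ∀ σ p, S i b = some (σ, p) → (∀ j, row A j (z.2 b i).1 ≤ z.1 σ j) ∧
          (sl i).PathHoldsRelaxed p (z.2 b i).1 (z.2 b i).2.1 (z.2 b i).2.2 ∧
          z.1 b i ≤ row A i (z.2 b i).2.1} := by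
      ext z
      simp [s]
    rw [hset]
    refine .iInter fun b => .iInter fun i => ?_
    by_cases hb : Unreachable P.initB S b
    · simpa [hb] using Polyhedral.univ
    rcases hS : S i b with _ | ⟨σ, p⟩
    · have h1 : IsLinearMap ℚ fun z : V => z.1 b i := isLinearMap_of_comb fun _ _ _ _ => rfl
      simpa [hb] using Polyhedral.halfspace h1 (row A i P.initX)
    · have h1 : ∀ j, Polyhedral {z : V | row A j (z.2 b i).1 ≤ z.1 σ j} := fun j => by
        have h : IsLinearMap ℚ fun z : V => row A j (z.2 b i).1 - z.1 σ j :=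
          isLinearMap_of_comb fun s t x z => by
            change row A j (s • (x.2 b i).1 + t • (z.2 b i).1) - (s * x.1 σ j + t * z.1 σ j) = _
            rw [row_comb]
            ring
        simpa using Polyhedral.halfspace h 0
      have h2 : ∀ a : LinAtom m E,
          Polyhedral {z : V | a.relax.Holds (z.2 b i).1 (z.2 b i).2.1 (z.2 b i).2.2} := fun a => by
        have h : IsLinearMap ℚ fun z : V => a.lhs (z.2 b i).1 (z.2 b i).2.1 (z.2 b i).2.2 :=
          isLinearMap_of_comb fun s t x z => a.lhs_comb _ _ _ _ _ _ s t
        obtain ⟨_, _, _, cmp, k⟩ := a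
        cases cmp
        · exact Polyhedral.halfspace h k
        · exact Polyhedral.halfspace h k
        · exact Polyhedral.hyperplane h k
      have h3 : Polyhedral {z : V | z.1 b i ≤ row A i (z.2 b i).2.1} := by
        have h : IsLinearMap ℚ fun z : V => z.1 b i - row A i (z.2 b i).2.1 :=
          isLinearMap_of_comb fun s t x z => by
            change s * x.1 b i + t * z.1 b i -
              row A i (s • (x.2 b i).2.1 + t • (z.2 b i).2.1) = _
            rw [row_comb]
            ring
        simpa using Polyhedral.halfspace h 0
      have h4 := (Polyhedral.iInter h1).inter
        ((Polyhedral.forall_mem_list ((sl i).subst p).atoms h2).inter h3)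
      convert h4 using 1
      ext z
      simp only [hb, Formula.PathHoldsRelaxed, Set.mem_ofPred_eq, Set.mem_inter_iff,
        Set.mem_iInter, not_false_eq_true, true_implies, reduceCtorEq, false_implies, true_and,
        Option.some.injEq, Prod.mk.injEq]
      exact ⟨fun h => h σ p ⟨rfl, rfl⟩, fun h σ' p' h' => by
        obtain ⟨rfl, rfl⟩ := h'
        exact h⟩
  have hlift : ∀ w, FullFeasible P A sl S w ↔ ∃ q, (w, q) ∈ s := by
    intro w
    constructor
    · intro hw
      have : ∀ b i, ∃ q : NState m × NState m × (Fin E → ℚ), ¬ Unreachable P.initB S b →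
          ∀ σ p, S i b = some (σ, p) → (∀ j, row A j q.1 ≤ w σ j) ∧
            (sl i).PathHoldsRelaxed p q.1 q.2.1 q.2.2 ∧ w b i ≤ row A i q.2.1 := by
        intro b i
        by_cases hb : Unreachable P.initB S b
        · exact ⟨0, fun h => absurd hb h⟩
        rcases hS : S i b with _ | ⟨σ, p⟩
        · exact ⟨0, fun _ σ p h => by simp at h⟩
        · obtain ⟨x, x', y, hx, hp, hr⟩ := (hw b i hb).2 σ p hS
          refine ⟨(x, x', y), fun _ σ' p' h => ?_⟩
          cases h
          exact ⟨sat_finVal.1 hx, hp, hr⟩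
      choose q hq using this
      exact ⟨q, fun b i hb => ⟨(hw b i hb).1, hq b i hb⟩⟩
    · rintro ⟨q, hq⟩ b i hb
      refine ⟨(hq b i hb).1, fun σ p hS => ?_⟩
      obtain ⟨h1, h2, h3⟩ := (hq b i hb).2 σ p hS
      exact ⟨_, _, _, sat_finVal.2 h1, h2, h3⟩
  have hf : IsLinearMap ℚ fun z : V => z.1 b i := isLinearMap_of_comb fun _ _ _ _ => rfl
  obtain ⟨w, hw⟩ := hne
  obtain ⟨q, hq⟩ := (hlift w).1 hw
  rcases hs.unbounded_or_max ⟨_, hq⟩ hf with h | ⟨z, hz, hmax⟩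
  · left
    intro M
    obtain ⟨z, hz, hM⟩ := h M
    exact ⟨z.1, (hlift _).2 ⟨z.2, hz⟩, hM⟩
  · right
    refine ⟨z.1, (hlift _).2 ⟨z.2, hz⟩, fun w' hw' => ?_⟩
    obtain ⟨q', hq'⟩ := (hlift w').1 hw'
    exact hmax _ hq'

/-! ### Invariants of strategy iteration -/

/-- `ρ` bounds the solutions of the linear program for `S`. -/
def IsTop (P : Program n m d E) (A : Matrix (Fin l) (Fin m) ℚ)
    (sl : Fin l → Formula n m d E) (S : Strategy n d l) (ρ : AbsVal n l) : Prop :=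
  ∀ w, FullFeasible P A sl S w → ∀ b i, ¬ Unreachable P.initB S b → fin (w b i) ≤ ρ b i

/-- What holds of the current strategy and value throughout strategy iteration.  The field `hist`
records that no set of entries can support itself: at the last change inside the set, some entry
was strictly improved. -/
structure Invariant (P : Program n m d E) (A : Matrix (Fin l) (Fin m) ℚ)
    (sl : Fin l → Formula n m d E) (S : Strategy n d l) (ρ : AbsVal n l) : Prop where
  bot : ∀ b, Unreachable P.initB S b → ∀ i, ρ b i = ⊥
  approx : ∀ M : ℚ, ∃ w, FullFeasible P A sl S w ∧
    ∀ b i, ¬ Unreachable P.initB S b → ∀ q ≤ M, fin q ≤ ρ b i → q ≤ w b i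
  hist : ∀ T : Finset (BState n × Fin l), T.Nonempty →
    (∀ k ∈ T, S k.2 k.1 ≠ none ∧ ρ k.1 k.2 < ⊤) →
    ∃ u ≤ ρ,
      (∀ k ∈ T, ∃ σ p r, S k.2 k.1 = some (σ, p) ∧ Attain A (sl k.2) p k.2 (u σ) r ∧
        u k.1 k.2 ≤ fin r) ∧
      ∃ k ∈ T, ∃ σ p r, S k.2 k.1 = some (σ, p) ∧ Attain A (sl k.2) p k.2 (u σ) r ∧
        u k.1 k.2 < fin r
  model : ∀ i b σ p, S i b = some (σ, p) →
    ∃ x x' y, Sat A x (ρ σ) ∧ (sl i).Holds σ x b x' p y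
  le_inductive : ∀ η, IsInductive P A η → ρ ≤ η
  rows : ∀ b ≠ P.initB, ∀ i j, S i b = none → S j b = none
  init : initVal P A ≤ ρ

/-- `η` is closed under the transitions selected by the strategy. -/
def StrictPost (A : Matrix (Fin l) (Fin m) ℚ) (sl : Fin l → Formula n m d E)
    (S : Strategy n d l) (η : AbsVal n l) : Prop :=
  ∀ i b σ p, S i b = some (σ, p) → ∀ x x' y, Sat A x (η σ) → (sl i).PathHolds p x x' y →
    fin (row A i x') ≤ η b i

/-- `η` is closed under the relaxed transitions selected by the strategy. -/
def RelaxedPost (A : Matrix (Fin l) (Fin m) ℚ) (sl : Fin l → Formula n m d E)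
    (S : Strategy n d l) (η : AbsVal n l) : Prop :=
  ∀ i b σ p, S i b = some (σ, p) → ∀ r, Attain A (sl i) p i (η σ) r → fin r ≤ η b i

/-! ### Reachable states, closed values and the bound on the linear program -/

theorem not_unreachable_init : ¬ Unreachable P.initB S P.initB := by
  intro h
  cases h with
  | base i _ hb => exact hb rfl
  | step i _ b p hb => exact hb rfl

section
variable {ρ : AbsVal n l}

/-- The argument `i` witnesses that there is a row at all: for `l = 0` the bound `⊥` constrains
nothing. -/
theorem Invariant.reachable_of_sat (h : Invariant P A sl S ρ) (i : Fin l) {x : NState m} {σ : BState n}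
    (hx : Sat A x (ρ σ)) : ¬ Unreachable P.initB S σ := fun hσ =>
  not_fin_le_bot _ (h.bot σ hσ i ▸ hx i)

theorem Invariant.source_reachable (h : Invariant P A sl S ρ) {i : Fin l} {b σ : BState n} {p : Path d}
    (hS : S i b = some (σ, p)) : ¬ Unreachable P.initB S σ := by
  obtain ⟨x, x', y, hx, -⟩ := h.model i b σ p hS
  exact h.reachable_of_sat i hx

/-- The recursive rule for `Z` never fires, because recorded departure states are reachable. So a
state of `Z` has an entry `⊥` in some row, and the field `rows` spreads it to all rows. -/
theorem Invariant.eq_none_of_unreachable (h : Invariant P A sl S ρ) {b : BState n}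
    (hb : Unreachable P.initB S b) (i : Fin l) : S i b = none := by
  cases hb with
  | base j _ hb hj => exact h.rows b hb j i hj
  | step j _ σ p hb hj hσ => exact absurd hσ (h.source_reachable hj)

theorem eq_init_of_none {b : BState n} {i : Fin l} (hS : S i b = none)
    (hb : ¬ Unreachable P.initB S b) : b = P.initB := by
  by_contra hne
  exact hb (.base i b hne hS)

theorem Invariant.init_le (h : Invariant P A sl S ρ) (i : Fin l) : fin (row A i P.initX) ≤ ρ P.initB i := by
  simpa [initVal] using h.init P.initB i

/-- The recorded model provides the Boolean part of the transition, and slicing then provides a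
transition of the program with at least the same value in row `i`. -/
theorem Invariant.strictPost_of_isInductive (h : Invariant P A sl S ρ)
    (hsl : ∀ i, IsSlice P A i (sl i)) {η : AbsVal n l}
    (hη : IsInductive P A η) : StrictPost A sl S η := by
  intro i b σ p hS x x' y hx hp
  obtain ⟨x₀, x₀', y₀, -, hφ⟩ := h.model i b σ p hS
  obtain ⟨z', hz', hle⟩ := ((hsl i).2 σ x b (row A i x')).2
    ⟨x', ⟨y, p, hφ.of_pathHolds (hsl i).1 hp⟩, le_rfl⟩
  exact (fin_le_fin.2 hle).trans (hη.2 σ x b z' hx hz' i)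

/-- The recorded model satisfies the bounds `ρ ≤ η`, hence is the strict solution needed to pass
from `<` to `≤`. -/
theorem Invariant.relaxedPost (h : Invariant P A sl S ρ) (hsl : ∀ i, IsSlice P A i (sl i))
    {η : AbsVal n l} (hρ : ρ ≤ η) (hη : StrictPost A sl S η) : RelaxedPost A sl S η := by
  intro i b σ p hS r hr
  obtain ⟨z, z', v, hz, hφ⟩ := h.model i b σ p hS
  exact hr.le_of_strict (hz.mono (hρ σ)) (hφ.pathHolds (hsl i).1) (hη i b σ p hS)

/-- Solutions of the linear program lie below every closed value above the current one. -/
theorem Invariant.le_of_relaxedPost (h : Invariant P A sl S ρ) (hsl : ∀ i, IsSlice P A i (sl i))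
    {η : AbsVal n l} (hρ : ρ ≤ η)
    (hη : RelaxedPost A sl S η) {w : BState n → Fin l → ℚ} (hw : FullFeasible P A sl S w) :
    ∀ b i, ¬ Unreachable P.initB S b → fin (w b i) ≤ η b i := by
  classical
  -- This is needed to keep the truncations of values below `η` below `η`.
  have hbot : ∀ b i, ¬ Unreachable P.initB S b → η b i ≠ ⊥ := by
    intro b i hb he
    rcases hS : S i b with _ | ⟨σ, p⟩
    · rw [eq_init_of_none hS hb] at he
      exact not_fin_le_bot _ (he ▸ (h.init_le i).trans (hρ _ _))
    · obtain ⟨x, x', y, hx, hφ⟩ := h.model i b σ p hS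
      exact not_fin_le_bot _ (he ▸ hη i b σ p hS (row A i x')
        ⟨x, x', y, hx.mono (hρ σ), (hφ.pathHolds (hsl i).1).relaxed, le_rfl⟩)
  let bad : (BState n → Fin l → ℚ) → Finset (BState n × Fin l) := fun w =>
    Finset.univ.filter fun k => ¬ Unreachable P.initB S k.1 ∧ η k.1 k.2 < fin (w k.1 k.2)
  have hmem : ∀ w k, k ∈ bad w ↔
      ¬ Unreachable P.initB S k.1 ∧ η k.1 k.2 < fin (w k.1 k.2) := fun w k => by simp [bad]
  -- Induction on the number of entries where `w` exceeds `η`. Attainment is assumed at those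
  -- entries only, since the interpolated point used below need not be feasible elsewhere.
  have key : ∀ N : ℕ, ∀ w : BState n → Fin l → ℚ, (bad w).card = N →
      (∀ k ∈ bad w, ∃ σ p, S k.2 k.1 = some (σ, p) ∧
        Attain A (sl k.2) p k.2 (finVal w σ) (w k.1 k.2)) → bad w = ∅ := by
    intro N
    induction N using Nat.strong_induction_on with
    | _ N ih =>
    intro w hN hatt
    by_contra hne
    have hT := Finset.nonempty_iff_ne_empty.2 hne
    obtain ⟨u, hu, hweak, k₀, hk₀, σ₀, p₀, r₀, hS₀, hr₀, hlt₀⟩ := h.hist (bad w) hT fun k hk => by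
      obtain ⟨σ, p, hS, -⟩ := hatt k hk
      exact ⟨by simp [hS], (hρ _ _).trans_lt (((hmem w k).1 hk).2.trans (fin_lt_top _))⟩
    have hev : ∀ {r : ℚ} {i : Fin l} {p : Path d} {σ : BState n},
        Attain A (sl i) p i (u σ) r →
        ∀ᶠ N in atTop, Attain A (sl i) p i (finVal (fun b j => trunc N (u b j)) σ) r := by
      rintro r i p σ ⟨x, x', y, hx, hp, hr⟩
      filter_upwards [eventually_all.2 fun j => eventually_le_trunc (hx j)] with N hN
      exact ⟨x, x', y, sat_finVal.2 hN, hp, hr⟩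
    have hev1 : ∀ᶠ N in atTop, ∀ k ∈ bad w, ∃ σ p, S k.2 k.1 = some (σ, p) ∧
        Attain A (sl k.2) p k.2 (finVal (fun b j => trunc N (u b j)) σ)
          (trunc N (u k.1 k.2)) := by
      refine (eventually_all_finset _).2 fun k hk => ?_
      obtain ⟨σ, p, r, hS, hr, hle⟩ := hweak k hk
      filter_upwards [hev hr, eventually_fin_trunc_le hle
        (ne_of_gt (bot_lt_fin r))] with N h1 h2
      exact ⟨σ, p, hS, h1.mono le_rfl (fin_le_fin.1 h2)⟩
    have hev2 : ∀ᶠ N in atTop, ∀ b i, ¬ Unreachable P.initB S b →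
        fin (trunc N (u b i)) ≤ η b i := by
      refine eventually_all.2 fun b => eventually_all.2 fun i => ?_
      by_cases hb : Unreachable P.initB S b
      · exact Eventually.of_forall fun _ h' => absurd hb h'
      · filter_upwards [eventually_fin_trunc_le ((hu b i).trans (hρ b i)) (hbot b i hb)] with N h'
        exact fun _ => h'
    obtain ⟨N', h1, h2, h3, h4⟩ :=
      (hev1.and (hev2.and ((hev hr₀).and (eventually_trunc_lt hlt₀)))).exists
    set v : BState n → Fin l → ℚ := fun b j => trunc N' (u b j) with hv
    obtain ⟨hz₀, hb₀⟩ := (hmem w k₀).1 hk₀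
    obtain ⟨e, he⟩ := exists_fin_of_le_of_lt (h2 k₀.1 k₀.2 hz₀) (hb₀.trans (fin_lt_top _))
    have hve : v k₀.1 k₀.2 ≤ e := by simpa [he] using h2 k₀.1 k₀.2 hz₀
    have hew : e < w k₀.1 k₀.2 := by simpa [he] using hb₀
    -- Chosen so that the combination `z` of `v` and `w` equals `η` exactly at `k₀`, where `v ≤ η <
    -- w`. Elsewhere convexity creates no new bad entry, so `z` has fewer of them.
    let t := (e - v k₀.1 k₀.2) / (w k₀.1 k₀.2 - v k₀.1 k₀.2)
    have hd : 0 < w k₀.1 k₀.2 - v k₀.1 k₀.2 := by linarith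
    have ht0 : 0 ≤ t := div_nonneg (by linarith) hd.le
    have ht1 : t < 1 := (div_lt_one hd).2 (by linarith)
    have hs0 : 0 ≤ 1 - t := by linarith
    have htd : t * (w k₀.1 k₀.2 - v k₀.1 k₀.2) = e - v k₀.1 k₀.2 := div_mul_cancel₀ _ hd.ne'
    set z : BState n → Fin l → ℚ := (1 - t) • v + t • w with hz
    have hzval : ∀ b i, z b i = (1 - t) * v b i + t * w b i := fun b i => rfl
    have hze : z k₀.1 k₀.2 = e := by
      rw [hzval]
      linarith
    have hsub : bad z ⊆ bad w := by
      intro k hk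
      rw [hmem] at hk ⊢
      refine ⟨hk.1, not_le.1 fun hle => ?_⟩
      refine not_le.2 hk.2 ?_
      rw [hzval]
      exact fin_convex_le hs0 ht0 (by ring) (h2 _ _ hk.1) hle
    have hk₀' : k₀ ∉ bad z := by
      rw [hmem, hze, he]
      exact fun h' => lt_irrefl _ h'.2
    have hzatt : ∀ k ∈ bad w, ∃ σ p, S k.2 k.1 = some (σ, p) ∧
        Attain A (sl k.2) p k.2 (finVal z σ) (z k.1 k.2) := by
      intro k hk
      obtain ⟨σ, p, hS, ha⟩ := h1 k hk
      obtain ⟨σ', p', hS', ha'⟩ := hatt k hk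
      rw [hS] at hS'
      cases hS'
      exact ⟨σ, p, hS, ha.comb hs0 ht0 (by ring) ha'⟩
    have hempty := ih (bad z).card
      (hN ▸ Finset.card_lt_card ((Finset.ssubset_iff_of_subset hsub).2 ⟨k₀, hk₀, hk₀'⟩)) z rfl
      fun k hk => hzatt k (hsub hk)
    have hle : ∀ b i, ¬ Unreachable P.initB S b → fin (z b i) ≤ η b i := fun b i hb =>
      not_lt.1 fun hlt => Finset.notMem_empty (b, i) (hempty ▸ (hmem z (b, i)).2 ⟨hb, hlt⟩)
    -- Now `z ≤ η` on the reachable states. From the bounds `z`, the entry `k₀` attains `(1 - t) *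
    -- r₀ + t * w`, which exceeds its own value `e` because `v < r₀` there and `t < 1`; this
    -- contradicts the closedness of `η`.
    obtain ⟨σ', p', hS', ha'⟩ := hatt k₀ hk₀
    rw [hS₀] at hS'
    cases hS'
    have hfin := hη k₀.2 k₀.1 σ₀ p₀ hS₀ _ ((h3.comb hs0 ht0 (by ring) ha').mono
      (fun j => hle σ₀ j (h.source_reachable hS₀)) le_rfl)
    rw [he, fin_le_fin] at hfin
    have hs1 : 0 < 1 - t := by linarith
    have := mul_lt_mul_of_pos_left h4 hs1
    rw [hzval] at hze
    linarith
  have hres := key _ w rfl fun k hk => by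
    obtain ⟨hb, hlt⟩ := (hmem w k).1 hk
    rcases hS : S k.2 k.1 with _ | ⟨σ, p⟩
    · have h1 := (hw k.1 k.2 hb).1 hS
      rw [eq_init_of_none hS hb] at hlt h1
      exact absurd ((fin_le_fin.2 h1).trans ((h.init_le k.2).trans (hρ _ _))) (not_le.2 hlt)
    · exact ⟨σ, p, rfl, (hw k.1 k.2 hb).2 σ p hS⟩
  exact fun b i hb =>
    not_lt.1 fun hlt => Finset.notMem_empty (b, i) (hres ▸ (hmem w (b, i)).2 ⟨hb, hlt⟩)

end

end Evaluation

section Improvement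
variable {n m d E l : ℕ} {A : Matrix (Fin l) (Fin m) ℚ} {P : Program n m d E}
  {sl : Fin l → Formula n m d E} {S S' : Strategy n d l} {ρ ρ' : AbsVal n l}

/-! ### Improving a strategy -/

/-- `S'` is an improvement of `S` at `ρ`, for the transition formula `sl i` in row `i`. -/
def Improves (A : Matrix (Fin l) (Fin m) ℚ) (sl : Fin l → Formula n m d E) (ρ : AbsVal n l)
    (S S' : Strategy n d l) : Prop :=
  ∀ i b',
    (∃ b x x' p y, Violates A (sl i) ρ i b x b' x' p y ∧ S' i b' = some (b, p)) ∨
    ((¬ ∃ b x x' p y, Violates A (sl i) ρ i b x b' x' p y) ∧ S' i b' = S i b')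

/-- Some row is violated at `ρ`, for the transition formula `sl i` in row `i`. -/
def Violable (A : Matrix (Fin l) (Fin m) ℚ) (sl : Fin l → Formula n m d E) (ρ : AbsVal n l) :
    Prop :=
  ∃ i b x b' x' p y, Violates A (sl i) ρ i b x b' x' p y

theorem Improves.ne_none (h : Improves A sl ρ S S') {i : Fin l} {b : BState n}
    (hS : S i b ≠ none) : S' i b ≠ none := by
  rcases h i b with ⟨_, _, _, _, _, -, h'⟩ | ⟨-, h'⟩
  · simp [h']
  · rwa [h']

/-- A state without any bound that is reached in one row is reached in all rows. -/
theorem Violates.other_row (hsl : ∀ i, IsSlice P A i (sl i)) {i : Fin l} {b : BState n}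
    {x : NState m} {b' : BState n} {x' : NState m} {p : Path d} {y : Fin E → ℚ}
    (h : Violates A (sl i) ρ i b x b' x' p y) (j : Fin l) (hj : ρ b' j = ⊥) :
    ∃ z p y, Violates A (sl j) ρ j b x b' z p y := by
  obtain ⟨z, hz, -⟩ := ((hsl i).2 b x b' (row A i x')).2 ⟨x', ⟨y, p, h.2.1⟩, le_rfl⟩
  obtain ⟨z', ⟨y', p', hz'⟩, -⟩ := ((hsl j).2 b x b' (row A j z)).1 ⟨z, hz, le_rfl⟩
  exact ⟨z', p', y', h.1, hz', hj ▸ bot_lt_fin _⟩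

/-- A violating model departs from a state that satisfies `ρ`, hence from outside `Z`; so a new
entry never adds to `Z`. -/
theorem Invariant.unreachable_of_improves (h : Invariant P A sl S ρ) (hi : Improves A sl ρ S S')
    {b : BState n} (hb : Unreachable P.initB S' b) : Unreachable P.initB S b := by
  induction hb with
  | base i b hne hn =>
    rcases hi i b with ⟨_, _, _, _, _, -, h'⟩ | ⟨-, h'⟩
    · simp [hn] at h'
    · exact .base i b hne (h' ▸ hn)
  | step i b' b p hne hs _ ih =>
    rcases hi i b' with ⟨b₁, x, x', p₁, y, hv, h'⟩ | ⟨-, h'⟩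
    · rw [hs] at h'
      cases h'
      exact absurd ih (h.reachable_of_sat i hv.1)
    · exact .step i b' b p hne (h' ▸ hs) ih

/-- A feasible point for the old strategy that is close enough to `ρ` admits the new departures, and
by `IsTop` it stays below the new arrivals. Only states that leave `Z` need another value. -/
theorem Invariant.improve_approx (h : Invariant P A sl S ρ) (ht : IsTop P A sl S ρ)
    (hsl : ∀ i, IsSlice P A i (sl i)) (hi : Improves A sl ρ S S') (M₀ : ℚ) :
    ∃ w, FullFeasible P A sl S' w ∧
      ∀ b i, ¬ Unreachable P.initB S' b → ∀ q ≤ M₀, fin q ≤ ρ b i → q ≤ w b i := by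
  classical
  have hev : ∀ᶠ M : ℚ in atTop, ∀ i b, (∃ b₁ x x' p y, Violates A (sl i) ρ i b₁ x b x' p y) →
      ∃ σ p r x x' y, S' i b = some (σ, p) ∧ ρ b i < fin r ∧ Sat A x (ρ σ) ∧
        (sl i).PathHoldsRelaxed p x x' y ∧ r ≤ row A i x' ∧ (∀ j, row A j x ≤ M) ∧ -M ≤ r := by
    refine eventually_all.2 fun i => eventually_all.2 fun b => ?_
    rcases hi i b with ⟨σ, x, x', p, y, hv, hS⟩ | ⟨hn, -⟩
    · filter_upwards [eventually_all.2 fun j => eventually_ge_atTop (row A j x),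
        eventually_ge_atTop (-row A i x')] with M h1 h2
      exact fun _ => ⟨σ, p, row A i x', x, x', y, hS, hv.2.2, hv.1,
        (hv.2.1.pathHolds (hsl i).1).relaxed, le_rfl, h1, by linarith⟩
    · exact Eventually.of_forall fun _ hv => absurd hv hn
  obtain ⟨M, hM, hM₀⟩ := (hev.and (eventually_ge_atTop M₀)).exists
  obtain ⟨w, hw, hwM⟩ := h.approx M
  -- On the old `Z` the value of `w` was not constrained and may be too large; `-M` is below every
  -- newly attained value.
  let w' : BState n → Fin l → ℚ := fun b i => if Unreachable P.initB S b then -M else w b i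
  have hw' : ∀ b, ¬ Unreachable P.initB S b → w' b = w b := fun b hb => by
    ext i
    simp [w', hb]
  have hfin : ∀ b, ¬ Unreachable P.initB S b → finVal w' b = finVal w b := fun b hb => by
    ext i
    simp [finVal, hw' b hb]
  refine ⟨w', fun b i hb => ?_, fun b i hb q hq hle => ?_⟩
  · by_cases hv : ∃ b₁ x x' p y, Violates A (sl i) ρ i b₁ x b x' p y
    · obtain ⟨σ, p, r, x, x', y, hS, hlt, hx, hp, hr, hxM, hrM⟩ := hM i b hv
      refine ⟨fun hn => by simp [hn] at hS, fun σ' p' hS' => ?_⟩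
      rw [hS] at hS'
      cases hS'
      have hσ := h.reachable_of_sat i hx
      refine ⟨x, x', y, ?_, hp, le_trans ?_ hr⟩
      · rw [hfin σ hσ, sat_finVal]
        exact fun j => hwM σ j hσ _ (hxM j) (hx j)
      · by_cases hb' : Unreachable P.initB S b
        · simpa [w', hb'] using hrM
        · rw [hw' b hb']
          exact (fin_lt_fin.1 ((ht w hw b i hb').trans_lt hlt)).le
    · have hS : S' i b = S i b := ((hi i b).resolve_left fun ⟨b₁, x, x', p, y, h', _⟩ =>
        hv ⟨b₁, x, x', p, y, h'⟩).2
      rw [hS]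
      by_cases hb' : Unreachable P.initB S b
      · have hn := h.eq_none_of_unreachable hb' i
        rw [← hS] at hn
        exact absurd (eq_init_of_none hn hb ▸ hb') not_unreachable_init
      · rw [hw' b hb']
        refine ⟨(hw b i hb').1, fun σ p hs => ?_⟩
        rw [hfin σ (h.source_reachable hs)]
        exact (hw b i hb').2 σ p hs
  · by_cases hb' : Unreachable P.initB S b
    · exact absurd (h.bot b hb' i ▸ hle) (not_fin_le_bot _)
    · rw [hw' b hb']
      exact hwM b i hb' q (hq.trans hM₀) hle

theorem Invariant.improve (h : Invariant P A sl S ρ) (ht : IsTop P A sl S ρ)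
    (hsl : ∀ i, IsSlice P A i (sl i)) (hi : Improves A sl ρ S S') : Invariant P A sl S' ρ where
  bot b hb := h.bot b (h.unreachable_of_improves hi hb)
  approx := h.improve_approx ht hsl hi
  hist T hT hfin := by
    -- If `T` meets the violated entries, `u = ρ` works: these entries increase strictly, and the
    -- others are supported because `ρ` is approached by feasible points. Otherwise nothing changes
    -- on `T` and the old `u` is kept.
    by_cases hch : ∃ k ∈ T, ∃ b x x' p y, Violates A (sl k.2) ρ k.2 b x k.1 x' p y
    · have hstr : ∀ k : BState n × Fin l,
          (∃ b x x' p y, Violates A (sl k.2) ρ k.2 b x k.1 x' p y) →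
          ∃ σ p r, S' k.2 k.1 = some (σ, p) ∧ Attain A (sl k.2) p k.2 (ρ σ) r ∧
            ρ k.1 k.2 < fin r := by
        intro k hk
        rcases hi k.2 k.1 with ⟨σ, x, x', p, y, hv, hS⟩ | ⟨hn, -⟩
        · exact ⟨σ, p, _, hS, hv.attain (hsl k.2).1, hv.2.2⟩
        · exact absurd hk hn
      obtain ⟨k₀, hk₀, hv₀⟩ := hch
      refine ⟨ρ, le_rfl, fun k hk => ?_, k₀, hk₀, hstr k₀ hv₀⟩
      rcases hi k.2 k.1 with ⟨b, x, x', p, y, hv, -⟩ | ⟨-, hS⟩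
      · obtain ⟨σ, p, r, h1, h2, h3⟩ := hstr k ⟨b, x, x', p, y, hv⟩
        exact ⟨σ, p, r, h1, h2, h3.le⟩
      · obtain ⟨hne, hlt⟩ := hfin k hk
        obtain ⟨⟨σ, p⟩, hs⟩ := Option.ne_none_iff_exists'.1 hne
        have hs' := hS ▸ hs
        have hreach : ¬ Unreachable P.initB S k.1 := fun hb => by
          simp [h.eq_none_of_unreachable hb k.2] at hs'
        -- The entry is not `+∞`, so approximation up to a bound `M` of its value reaches that
        -- value.
        obtain ⟨M, hM⟩ : ∃ M : ℚ, ρ k.1 k.2 ≤ fin M := by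
          rcases qbar_cases (ρ k.1 k.2) with hq | hq | ⟨M, hq⟩
          · exact ⟨0, hq ▸ bot_le⟩
          · exact absurd (hq ▸ hlt) (lt_irrefl _)
          · exact ⟨M, hq.le⟩
        obtain ⟨w, hw, hwM⟩ := h.approx M
        refine ⟨σ, p, w k.1 k.2, hs, ((hw k.1 k.2 hreach).2 σ p hs').mono
          (fun j => ht w hw σ j (h.source_reachable hs')) le_rfl, ?_⟩
        exact le_of_forall_fin_le fun q hq =>
          fin_le_fin.2 (hwM _ _ hreach q (fin_le_fin.1 (hq.trans hM)) hq)
    · have hsame : ∀ k ∈ T, S' k.2 k.1 = S k.2 k.1 := fun k hk =>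
        ((hi k.2 k.1).resolve_left fun ⟨b, x, x', p, y, hv, _⟩ =>
          hch ⟨k, hk, b, x, x', p, y, hv⟩).2
      obtain ⟨u, hu, hweak, k₀, hk₀, hstr⟩ := h.hist T hT fun k hk => hsame k hk ▸ hfin k hk
      refine ⟨u, hu, fun k hk => ?_, k₀, hk₀, ?_⟩
      · rw [hsame k hk]
        exact hweak k hk
      · rw [hsame k₀ hk₀]
        exact hstr
  model i b σ p hS := by
    rcases hi i b with ⟨σ', x, x', p', y, hv, h'⟩ | ⟨-, h'⟩
    · rw [hS] at h'
      cases h'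
      exact ⟨x, x', y, hv.1, hv.2.1⟩
    · exact h.model i b σ p (h' ▸ hS)
  le_inductive := h.le_inductive
  rows b hb i j hn := by
    have hni : ¬ ∃ b₁ x x' p y, Violates A (sl i) ρ i b₁ x b x' p y := by
      rcases hi i b with ⟨_, _, _, _, _, -, h'⟩ | ⟨hv, -⟩
      · simp [hn] at h'
      · exact hv
    have hSi : S i b = none := by
      rcases hi i b with ⟨_, _, _, _, _, -, h'⟩ | ⟨-, h'⟩
      · simp [hn] at h'
      · rw [← h', hn]
    rcases hi j b with ⟨b₁, x, x', p, y, hv, -⟩ | ⟨-, h'⟩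
    -- The state was in `Z`, so all its bounds are `⊥` and a violation in row `j` would be one in
    -- row `i`.
    · obtain ⟨z, p', y', hv'⟩ := hv.other_row hsl i (h.bot b (.base i b hb hSi) i)
      exact absurd ⟨b₁, x, z, p', y', hv'⟩ hni
    · rw [h']
      exact h.rows b hb i j hSi
  init := h.init

/-! ### Evaluating a strategy -/

/-- Dropping the constraints at infinite entries is harmless: the maximum of `v` with a feasible `w`
that is at least `M` at those entries takes its values there from `w`, whose constraints hold. -/
theorem Invariant.exists_fullFeasible_ge (h : Invariant P A sl S ρ) {v : Unknowns S}
    (hv : Feasible P A sl S ρ v) :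
    ∃ w, FullFeasible P A sl S w ∧ ∀ b i, v.at i b ≤ w b i := by
  obtain ⟨M, hM⟩ : ∃ M : ℚ, ∀ b i, v.at i b ≤ M :=
    (eventually_all.2 fun b => eventually_all.2 fun i => eventually_ge_atTop (v.at i b)).exists
  obtain ⟨w, hw, hwM⟩ := h.approx M
  let v' : BState n → Fin l → ℚ := fun b i => v.at i b
  refine ⟨v' ⊔ w, fun b i hb => ?_, fun b i => le_sup_left (a := v' b i)⟩
  have hwhole := hw b i hb
  by_cases htop : ρ b i < ⊤
  · have hc := hv i b hb htop
    refine ⟨fun hn => ?_, fun σ p hS => ?_⟩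
    · rw [hn] at hc
      exact sup_le hc (hwhole.1 hn)
    · rw [hS] at hc
      obtain ⟨x, x', y, hx, hr, hp⟩ := hc
      rcases le_total (v' b i) (w b i) with hle | hle
      · exact (hwhole.2 σ p hS).mono (finVal_mono le_sup_right σ) (sup_le hle le_rfl)
      · exact (show Attain A (sl i) p i (finVal v' σ) (v' b i) from
          ⟨x, x', y, sat_finVal.2 hx, hp, hr⟩).mono (finVal_mono le_sup_left σ)
          (sup_le le_rfl hle)
  · have hle : v' b i ≤ w b i := (hM b i).trans
      (hwM b i hb M le_rfl (not_lt_top_iff.1 htop ▸ le_top))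
    refine ⟨fun hn => sup_le (hle.trans (hwhole.1 hn)) (hwhole.1 hn), fun σ p hS => ?_⟩
    exact (hwhole.2 σ p hS).mono (finVal_mono le_sup_right σ) (sup_le hle le_rfl)

/-- Merging a class is harmless: its members have the same constraint, so the maximum of `w` over
the reachable members keeps the witness of the member that attains it. -/
theorem Invariant.exists_feasible_ge (h : Invariant P A sl S ρ) {w : BState n → Fin l → ℚ}
    (hw : FullFeasible P A sl S w) :
    ∃ v : Unknowns S, Feasible P A sl S ρ v ∧
      ∀ b i, ¬ Unreachable P.initB S b → w b i ≤ v.at i b := by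
  classical
  have hmax : ∀ i (c : Quotient (classSetoid S i)), ∃ q,
      (∀ b, ¬ Unreachable P.initB S b → Quotient.mk _ b = c → w b i ≤ q) ∧
      ((∃ b, ¬ Unreachable P.initB S b ∧ Quotient.mk _ b = c) →
        ∃ b, ¬ Unreachable P.initB S b ∧ Quotient.mk _ b = c ∧ q = w b i) := by
    intro i c
    by_cases hne : ∃ b, ¬ Unreachable P.initB S b ∧ Quotient.mk _ b = c
    · obtain ⟨b, hb, hbmax⟩ := Finset.exists_max_image
        (Finset.univ.filter fun b => ¬ Unreachable P.initB S b ∧ Quotient.mk _ b = c)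
        (fun b => w b i) ⟨hne.choose, by simpa using hne.choose_spec⟩
      simp only [Finset.mem_filter, Finset.mem_univ, true_and] at hb hbmax
      exact ⟨w b i, fun b' h1 h2 => hbmax b' ⟨h1, h2⟩, fun _ => ⟨b, hb.1, hb.2, rfl⟩⟩
    -- A class without reachable members is not constrained, and its value is arbitrary.
    · exact ⟨0, fun b h1 h2 => absurd ⟨b, h1, h2⟩ hne, fun h' => absurd h' hne⟩
  choose v hv1 hv2 using hmax
  have hge : ∀ b i, ¬ Unreachable P.initB S b → w b i ≤ Unknowns.at v i b :=
    fun b i hb => hv1 i _ b hb rfl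
  refine ⟨v, fun i b' hb' _ => ?_, hge⟩
  obtain ⟨b, hb, hclass, hval⟩ := hv2 i (Quotient.mk _ b') ⟨b', hb', rfl⟩
  have hSb : S i b = S i b' := Quotient.exact hclass
  have hval' : Unknowns.at v i b' = w b i := hval
  rcases hS : S i b' with _ | ⟨σ, p⟩
  · simp only
    rw [hval']
    exact (hw b i hb).1 (hSb.trans hS)
  · simp only
    rw [hval']
    obtain ⟨x, x', y, hx, hp, hr⟩ := (hw b i hb).2 σ p (hSb.trans hS)
    exact ⟨x, x', y, fun j => (sat_finVal.1 hx j).trans (hge σ j (h.source_reachable hS)), hr, hp⟩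

theorem Invariant.exists_fullFeasible (h : Invariant P A sl S ρ) :
    ∃ w, FullFeasible P A sl S w := by
  obtain ⟨w, hw, -⟩ := h.approx 0
  exact ⟨w, hw⟩

theorem Invariant.isLUB_iff (h : Invariant P A sl S ρ) {b : BState n} (i : Fin l)
    (hb : ¬ Unreachable P.initB S b) (q : QBar) :
    IsLUB {q | ∃ v : Unknowns S, Feasible P A sl S ρ v ∧ q = fin (v.at i b)} q ↔
      IsLUB {q | ∃ w, FullFeasible P A sl S w ∧ q = fin (w b i)} q := by
  suffices hub : upperBounds {q | ∃ v : Unknowns S, Feasible P A sl S ρ v ∧ q = fin (v.at i b)} =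
      upperBounds {q | ∃ w, FullFeasible P A sl S w ∧ q = fin (w b i)} by
    rw [IsLUB, IsLUB, hub]
  ext q
  constructor
  · rintro hq _ ⟨w, hw, rfl⟩
    obtain ⟨v, hv, hle⟩ := h.exists_feasible_ge hw
    exact (fin_le_fin.2 (hle b i hb)).trans (hq ⟨v, hv, rfl⟩)
  · rintro hq _ ⟨v, hv, rfl⟩
    obtain ⟨w, hw, hle⟩ := h.exists_fullFeasible_ge hv
    exact (fin_le_fin.2 (hle b i)).trans (hq ⟨w, hw, rfl⟩)

theorem Invariant.exists_isReducedValue (h : Invariant P A sl S ρ) :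
    ∃ ρ', IsReducedValue P A sl S ρ ρ' := by
  have : ∀ b i, ∃ q : QBar, (Unreachable P.initB S b → q = ⊥) ∧ (¬ Unreachable P.initB S b →
      IsLUB {q | ∃ v : Unknowns S, Feasible P A sl S ρ v ∧ q = fin (v.at i b)} q) := by
    intro b i
    by_cases hb : Unreachable P.initB S b
    · exact ⟨⊥, fun _ => rfl, fun h' => absurd hb h'⟩
    rcases FullFeasible.unbounded_or_max h.exists_fullFeasible b i with hu | ⟨w, hw, hmax⟩
    · refine ⟨⊤, fun h' => absurd h' hb, fun _ => (h.isLUB_iff i hb _).2 ⟨fun _ _ => le_top, ?_⟩⟩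
      intro q hq
      refine le_of_forall_fin_le fun M _ => ?_
      obtain ⟨w, hw, hM⟩ := hu M
      exact (fin_le_fin.2 hM).trans (hq ⟨w, hw, rfl⟩)
    · refine ⟨fin (w b i), fun h' => absurd h' hb, fun _ => (h.isLUB_iff i hb _).2 ⟨?_, ?_⟩⟩
      · rintro _ ⟨w', hw', rfl⟩
        exact fin_le_fin.2 (hmax w' hw')
      · exact fun q hq => hq ⟨w, hw, rfl⟩
  choose ρ' hρ' using this
  exact ⟨ρ', hρ'⟩

theorem Invariant.isTop_reduced (h : Invariant P A sl S ρ) (hr : IsReducedValue P A sl S ρ ρ') :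
    IsTop P A sl S ρ' := fun w hw b i hb =>
  ((h.isLUB_iff i hb _).1 ((hr b i).2 hb)).1 ⟨w, hw, rfl⟩

theorem Invariant.reduced_le (h : Invariant P A sl S ρ) (hr : IsReducedValue P A sl S ρ ρ')
    {b : BState n} {i : Fin l} {q : QBar}
    (hq : ¬ Unreachable P.initB S b → ∀ w, FullFeasible P A sl S w → fin (w b i) ≤ q) :
    ρ' b i ≤ q := by
  by_cases hb : Unreachable P.initB S b
  · exact (hr b i).1 hb ▸ bot_le
  · refine ((h.isLUB_iff i hb _).1 ((hr b i).2 hb)).2 ?_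
    rintro _ ⟨w, hw, rfl⟩
    exact hq hb w hw

theorem Invariant.reduced_le_of_relaxedPost (h : Invariant P A sl S ρ)
    (hsl : ∀ i, IsSlice P A i (sl i)) (hr : IsReducedValue P A sl S ρ ρ') {η : AbsVal n l}
    (hρ : ρ ≤ η) (hη : RelaxedPost A sl S η) : ρ' ≤ η := fun b i =>
  h.reduced_le hr fun hb _ hw => h.le_of_relaxedPost hsl hρ hη hw b i hb

/-- Feasible points come up to every rational below `ρ`, and any bound on the program dominates
them. Hence evaluation never decreases the value. -/
theorem Invariant.le_of_isTop (h : Invariant P A sl S ρ) {η : AbsVal n l}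
    (hη : IsTop P A sl S η) : ρ ≤ η := by
  intro b i
  by_cases hb : Unreachable P.initB S b
  · exact h.bot b hb i ▸ bot_le
  · refine le_of_forall_fin_le fun q hq => ?_
    obtain ⟨w, hw, hle⟩ := h.approx q
    exact (fin_le_fin.2 (hle b i hb q le_rfl hq)).trans (hη w hw b i hb)

/-- Each unknown is unbounded or attains its optimum, and maxima of feasible points combine these
into `approx`. The field `le_inductive` rests on `hist`, through the bound on the program by closed
values. -/
theorem Invariant.reduced (h : Invariant P A sl S ρ) (hsl : ∀ i, IsSlice P A i (sl i))
    (hr : IsReducedValue P A sl S ρ ρ') : Invariant P A sl S ρ' :=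
  have hle : ρ ≤ ρ' := h.le_of_isTop (h.isTop_reduced hr)
  { bot := fun b hb i => (hr b i).1 hb
    approx := fun M => by
      refine FullFeasible.exists_forall
        (Q := fun b i q' => ¬ Unreachable P.initB S b → ∀ q ≤ M, fin q ≤ ρ' b i → q ≤ q')
        (fun b i q q' hqq' hq hb r hr hr' => (hq hb r hr hr').trans hqq')
        h.exists_fullFeasible fun b i => ?_
      rcases FullFeasible.unbounded_or_max h.exists_fullFeasible b i with hu | ⟨w, hw, hmax⟩
      · obtain ⟨w, hw, hM⟩ := hu M
        exact ⟨w, hw, fun _ q hq _ => hq.trans hM⟩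
      · exact ⟨w, hw, fun _ q _ hq => fin_le_fin.1 (hq.trans
          (h.reduced_le hr fun _ w' hw' => fin_le_fin.2 (hmax w' hw')))⟩
    hist := fun T hT hfin => by
      obtain ⟨u, hu, hrest⟩ := h.hist T hT fun k hk =>
        ⟨(hfin k hk).1, (hle k.1 k.2).trans_lt (hfin k hk).2⟩
      exact ⟨u, hu.trans hle, hrest⟩
    model := fun i b σ p hS => by
      obtain ⟨x, x', y, hx, hφ⟩ := h.model i b σ p hS
      exact ⟨x, x', y, hx.mono (hle σ), hφ⟩
    le_inductive := fun η hη => h.reduced_le_of_relaxedPost hsl hr (h.le_inductive η hη)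
      (h.relaxedPost hsl (h.le_inductive η hη) (h.strictPost_of_isInductive hsl hη))
    rows := h.rows
    init := h.init.trans hle }

/-- A value attained from the bounds `ρ` is attained from a feasible point close to `ρ`; raising the
entry to it keeps feasibility, so `ρ` already bounds it. -/
theorem Invariant.relaxedPost_of_isTop (h : Invariant P A sl S ρ) (ht : IsTop P A sl S ρ) :
    RelaxedPost A sl S ρ := by
  rintro i b σ p hS r ⟨x, x', y, hx, hp, hr⟩
  have hb : ¬ Unreachable P.initB S b := fun hb => by
    simp [h.eq_none_of_unreachable hb i] at hS
  obtain ⟨M, hM⟩ : ∃ M : ℚ, ∀ j, row A j x ≤ M :=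
    (eventually_all.2 fun j => eventually_ge_atTop (row A j x)).exists
  obtain ⟨w, hw, hwM⟩ := h.approx M
  obtain ⟨w', hw', hle⟩ := hw.raise hS ⟨x, x', y, sat_finVal.2 fun j =>
    hwM σ j (h.source_reachable hS) _ (hM j) (hx j), hp, hr⟩
  exact (fin_le_fin.2 hle).trans (ht w' hw' b i hb)

/-- An improved strategy differs from all strategies evaluated before. -/
theorem Invariant.improve_ne (h : Invariant P A sl S ρ) (ht : IsTop P A sl S ρ)
    (hsl : ∀ i, IsSlice P A i (sl i)) (hi : Improves A sl ρ S S') (hv : Violable A sl ρ)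
    {S₀ : Strategy n d l} {ρ₀ : AbsVal n l} (hρ₀ : ρ₀ ≤ ρ) (ht₀ : IsTop P A sl S₀ ρ₀) :
    S' ≠ S₀ := by
  rintro rfl
  have h' := h.improve ht hsl hi
  -- The old value bounds the program of the same strategy, so it is at least `ρ`. Then `ρ` is
  -- closed under the improved strategy, which contradicts the strict violation.
  obtain rfl : ρ = ρ₀ := le_antisymm (h'.le_of_isTop ht₀) hρ₀
  obtain ⟨i, b, x, b', x', p, y, hviol⟩ := hv
  rcases hi i b' with ⟨σ, z, z', p', v, hviol', hS⟩ | ⟨hn, -⟩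
  · exact not_le.2 hviol'.2.2
      (h'.relaxedPost_of_isTop ht₀ i b' σ p' hS _ (hviol'.attain (hsl i).1))
  · exact hn ⟨b, x, x', p, y, hviol⟩

/-- Where no row is violated, the current value is the least inductive invariant. -/
theorem Invariant.isLeast (h : Invariant P A sl S ρ) (hsl : ∀ i, IsSlice P A i (sl i))
    (hv : ¬ Violable A sl ρ) : IsLeast {η | IsInductive P A η} ρ := by
  refine ⟨⟨fun i => h.init_le i, fun b x b' x' hx ht i => ?_⟩, fun η hη => h.le_inductive η hη⟩
  by_contra hlt
  obtain ⟨z, ⟨y, p, hz⟩, hle⟩ := ((hsl i).2 b x b' (row A i x')).1 ⟨x', ht, le_rfl⟩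
  exact hv ⟨i, b, x, b', z, p, y, hx, hz, (not_le.1 hlt).trans_le (fin_le_fin.2 hle)⟩

/-! ### The initial strategy -/

theorem reachable_bot (i : Fin l) {b : BState n}
    (hb : ¬ Unreachable P.initB (botStrategy n d l) b) : b = P.initB :=
  eq_init_of_none (i := i) rfl hb

theorem invariant_init : Invariant P A sl (botStrategy n d l) (initVal P A) where
  bot b hb i := by
    have hne : b ≠ P.initB := fun he => not_unreachable_init (he ▸ hb)
    simp [initVal, hne]
  approx M := by
    refine ⟨fun _ i => row A i P.initX, fun b i hb => ⟨fun _ => le_rfl, fun σ p hS => ?_⟩,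
      fun b i hb q _ hq => ?_⟩
    · simp [botStrategy] at hS
    · simpa [initVal, reachable_bot i hb] using hq
  hist T hT h := by
    obtain ⟨k, hk⟩ := hT
    exact absurd rfl (h k hk).1
  model i b σ p hS := by simp [botStrategy] at hS
  le_inductive η hη b i := by
    by_cases hb : b = P.initB
    · subst hb
      simpa [initVal] using hη.1 i
    · simp [initVal, hb]
  rows b hb i j _ := rfl
  init := le_rfl

theorem isTop_init : IsTop P A sl (botStrategy n d l) (initVal P A) := by
  intro w hw b i hb
  have := (hw b i hb).1 rfl
  simpa [initVal, reachable_bot i hb] using this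

/-! ### Strategy values of the original iteration -/

theorem isSlice_self (i : Fin l) : IsSlice P A i P.T := ⟨P.encoded, fun _ _ _ _ => Iff.rfl⟩

/-- The value obtained from the linear program is the least fixed point above the current value. -/
theorem Invariant.isStrategyValue (h : Invariant P A (fun _ => P.T) S ρ)
    (hr : IsReducedValue P A (fun _ => P.T) S ρ ρ') : IsStrategyValue P A S ρ ρ' := by
  have hsl : ∀ i : Fin l, IsSlice P A i ((fun _ => P.T) i) := isSlice_self
  have ht := h.isTop_reduced hr
  have h' := h.reduced hsl hr
  refine ⟨⟨h.le_of_isTop ht, fun b i => ?_⟩, fun η hη => ?_⟩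
  · rcases hS : S i b with _ | ⟨σ, p⟩
    · have hset : psiSet P A S ρ' i b = {q | b = P.initB ∧ q = fin (row A i P.initX)} := by
        simp only [psiSet, hS]
      rw [hset]
      refine ⟨?_, fun q hq => h.reduced_le hr fun hb w hw => ?_⟩
      · rintro _ ⟨rfl, rfl⟩
        exact h'.init_le i
      · exact (fin_le_fin.2 ((hw b i hb).1 hS)).trans (hq ⟨eq_init_of_none hS hb, rfl⟩)
    · have hset : psiSet P A S ρ' i b =
          {q | ∃ x x' y, P.T.PathHolds p x x' y ∧ Sat A x (ρ' σ) ∧ q = fin (row A i x')} := by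
        simp only [psiSet, hS]
      rw [hset]
      refine ⟨?_, fun q hq => h.reduced_le hr fun hb w hw => ?_⟩
      · rintro _ ⟨x, x', y, hp, hx, rfl⟩
        exact h'.relaxedPost_of_isTop ht i b σ p hS _ ⟨x, x', y, hx, hp.relaxed, le_rfl⟩
      -- The recorded model is strict, so a bound on the strict solutions also bounds the relaxed
      -- value `w b i`.
      · obtain ⟨z, z', v, hz, hφ⟩ := h'.model i b σ p hS
        refine (((hw b i hb).2 σ p hS).mono (fun j => ht w hw σ j (h.source_reachable hS))
          le_rfl).le_of_strict hz (hφ.pathHolds P.encoded) fun x x' y hx hp => ?_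
        exact hq ⟨x, x', y, hp, hx, rfl⟩
  -- A fixed point above `ρ` is closed under the strict transitions, hence under the relaxed ones,
  -- and so lies above the linear program.
  · refine h.reduced_le_of_relaxedPost hsl hr hη.1 (h.relaxedPost hsl hη.1 ?_)
    intro i b σ p hS x x' y hx hp
    have hlub := (hη.2 b i).1
    simp only [psiSet, hS] at hlub
    exact hlub ⟨x, x', y, hp, hx, rfl⟩

end Improvement

section Execution
variable {n m d E l : ℕ}

/-! ### Counting strategies -/

noncomputable instance : DecidableEq (Strategy n d l) := Classical.decEq _

/-- The entries of a strategy that are not `⊥`. -/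
def support (S : Strategy n d l) : Finset (Fin l × BState n) :=
  Finset.univ.filter fun k => S k.1 k.2 ≠ none

theorem mem_support {S : Strategy n d l} {k : Fin l × BState n} :
    k ∈ support S ↔ S k.1 k.2 ≠ none := by simp [support]

theorem card_support_le (S : Strategy n d l) : (support S).card ≤ l * 2 ^ n := by
  refine (Finset.card_le_univ _).trans_eq ?_
  simp

/-- A strategy with support `T` is determined by its pairs on `T`, each one of `2 ^ (n + d)`. -/
theorem card_le_of_support_eq {V : Finset (Strategy n d l)} {T : Finset (Fin l × BState n)}
    (h : ∀ S ∈ V, support S = T) : V.card ≤ 2 ^ ((n + d) * T.card) := by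
  classical
  let f : Strategy n d l → T → BState n × Path d := fun S k => (S k.1.1 k.1.2).getD default
  have hf : Set.InjOn f V := by
    intro S hS S' hS' hSS'
    ext1 i
    ext1 b
    by_cases hk : (i, b) ∈ T
    · have h1 : S i b ≠ none := mem_support.1 ((h S hS).symm ▸ hk)
      have h2 : S' i b ≠ none := mem_support.1 ((h S' hS').symm ▸ hk)
      obtain ⟨q, hq⟩ := Option.ne_none_iff_exists'.1 h1
      obtain ⟨q', hq'⟩ := Option.ne_none_iff_exists'.1 h2
      have := congrFun hSS' ⟨(i, b), hk⟩
      simp only [f, hq, hq', Option.getD_some] at this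
      rw [hq, hq', this]
    · have h1 : S i b = none := by
        by_contra hne
        exact hk (h S hS ▸ mem_support.2 hne)
      have h2 : S' i b = none := by
        by_contra hne
        exact hk (h S' hS' ▸ mem_support.2 hne)
      rw [h1, h2]
  have hcard := Finset.card_le_card_of_injOn (t := Finset.univ) f (fun _ _ => Finset.mem_univ _) hf
  refine hcard.trans_eq ?_
  simp [← pow_add, ← pow_mul]

/-- In a chain, supports of equal size coincide; so each size `j` contributes the strategies on a
single support. -/
theorem card_le_of_chain {V : Finset (Strategy n d l)}
    (h : ∀ S ∈ V, ∀ S' ∈ V, support S ⊆ support S' ∨ support S' ⊆ support S) :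
    V.card ≤ ∑ j ∈ Finset.range (l * 2 ^ n + 1), 2 ^ ((n + d) * j) := by
  classical
  rw [Finset.card_eq_sum_card_fiberwise (f := fun S => (support S).card)
    (t := Finset.range (l * 2 ^ n + 1))
    fun S _ => Finset.mem_coe.2 (Finset.mem_range.2 (Nat.lt_succ_of_le (card_support_le S)))]
  refine Finset.sum_le_sum fun j _ => ?_
  rcases (V.filter fun S => (support S).card = j).eq_empty_or_nonempty with he | ⟨S₀, hS₀⟩
  · simp [he]
  · rw [Finset.mem_filter] at hS₀
    refine (card_le_of_support_eq (T := support S₀) fun S hS => ?_).trans_eq (by rw [hS₀.2])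
    rw [Finset.mem_filter] at hS
    rcases h S hS.1 S₀ hS₀.1 with hsub | hsub
    · exact Finset.eq_of_subset_of_card_le hsub (by rw [hS.2, hS₀.2])
    · exact (Finset.eq_of_subset_of_card_le hsub (by rw [hS.2, hS₀.2])).symm

/-- The strategies of a set that are nowhere `⊥`. -/
def fullStrategies (V : Finset (Strategy n d l)) : Finset (Strategy n d l) :=
  V.filter fun S => ∀ i b, S i b ≠ none

theorem card_fullStrategies_le (V : Finset (Strategy n d l)) :
    (fullStrategies V).card ≤ 2 ^ ((n + d) * l * 2 ^ n) := by
  refine (card_le_of_support_eq (T := Finset.univ) fun S hS => ?_).trans_eq ?_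
  · ext k
    simpa [mem_support] using (Finset.mem_filter.1 hS).2 k.1 k.2
  · simp [mul_assoc]

/-! ### Termination by a measure on annotated configurations -/

/-- The annotation `v` is ghost state: the measure may depend on the history of an execution without
the configuration recording it. -/
theorem terminates_of_measure {C ι : Type} {step : C → C → Prop} {H : Set C} (D : ι → C → Prop)
    (μ : ι → C → ℕ)
    (hstep : ∀ v c c', D v c → step c c' → ∃ v', D v' c' ∧ μ v' c' < μ v c)
    (hprog : ∀ v c, D v c → c ∈ H ∨ ∃ c', step c c') {v₀ : ι} {c₀ : C} (h₀ : D v₀ c₀) :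
    Terminates step H c₀ ∧ ∀ c, Relation.ReflTransGen step c₀ c → ∃ v, D v c := by
  have hreach : ∀ c, Relation.ReflTransGen step c₀ c → ∃ v, D v c := by
    intro c hc
    induction hc with
    | refl => exact ⟨v₀, h₀⟩
    | tail _ hs ih =>
      obtain ⟨v, hv⟩ := ih
      obtain ⟨v', hv', -⟩ := hstep _ _ _ hv hs
      exact ⟨v', hv'⟩
  have hacc : ∀ N v c, μ v c = N → D v c → Acc (fun c' c => step c c') c := by
    intro N
    induction N using Nat.strong_induction_on with
    | _ N ih =>
      intro v c hN hv
      refine ⟨_, fun c' hs => ?_⟩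
      obtain ⟨v', hv', hlt⟩ := hstep _ _ _ hv hs
      exact ih _ (hN ▸ hlt) v' c' rfl hv'
  refine ⟨⟨hacc _ v₀ c₀ rfl h₀, fun c hc => ?_⟩, hreach⟩
  obtain ⟨v, hv⟩ := hreach c hc
  exact hprog v c hv

theorem Terminates.exists_reachable {C : Type} {step : C → C → Prop} {H : Set C} {c₀ : C}
    (h : Terminates step H c₀) : ∃ c ∈ H, Relation.ReflTransGen step c₀ c := by
  obtain ⟨hacc, hprog⟩ := h
  have key : ∀ c, Acc (fun c' c => step c c') c → Relation.ReflTransGen step c₀ c →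
      ∃ c ∈ H, Relation.ReflTransGen step c₀ c := by
    intro c hc
    induction hc with
    | intro c _ ih =>
      intro hr
      rcases hprog c hr with hH | ⟨c', hs⟩
      · exact ⟨c, hH, hr⟩
      · exact ih c' hs (hr.tail hs)
  exact key c₀ hacc .refl

/-! ### Rounds of strategy iteration -/

variable {P : Program n m d E} {A : Matrix (Fin l) (Fin m) ℚ} {sl : Fin l → Formula n m d E}

/-- The strategies in `V` have been evaluated, the last one being `S`, with value `ρ`. -/
structure Visited (P : Program n m d E) (A : Matrix (Fin l) (Fin m) ℚ)
    (sl : Fin l → Formula n m d E) (V : Finset (Strategy n d l)) (S : Strategy n d l)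
    (ρ : AbsVal n l) : Prop where
  inv : Invariant P A sl S ρ
  top : IsTop P A sl S ρ
  mem : S ∈ V
  chain : ∀ S₁ ∈ V, ∀ S₂ ∈ V, support S₁ ⊆ support S₂ ∨ support S₂ ⊆ support S₁
  support_subset : ∀ S₀ ∈ V, support S₀ ⊆ support S
  value_le : ∀ S₀ ∈ V, ∃ ρ₀ ≤ ρ, IsTop P A sl S₀ ρ₀

theorem visited_init : Visited P A sl {botStrategy n d l} (botStrategy n d l) (initVal P A) where
  inv := invariant_init
  top := isTop_init
  mem := Finset.mem_singleton_self _
  chain S₁ h₁ S₂ h₂ := by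
    rw [Finset.mem_singleton.1 h₁, Finset.mem_singleton.1 h₂]
    exact Or.inl le_rfl
  support_subset S₀ h₀ := by rw [Finset.mem_singleton.1 h₀]
  value_le S₀ h₀ := ⟨_, le_rfl, Finset.mem_singleton.1 h₀ ▸ isTop_init⟩

section Round
variable {V : Finset (Strategy n d l)} {S S' : Strategy n d l} {ρ ρ' : AbsVal n l}

theorem Visited.notMem_of_improves (h : Visited P A sl V S ρ) (hsl : ∀ i, IsSlice P A i (sl i))
    (hi : Improves A sl ρ S S') (hv : Violable A sl ρ) : S' ∉ V := by
  intro hmem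
  obtain ⟨ρ₀, hρ₀, ht₀⟩ := h.value_le S' hmem
  exact h.inv.improve_ne h.top hsl hi hv hρ₀ ht₀ rfl

theorem Visited.insert (h : Visited P A sl V S ρ) (hsl : ∀ i, IsSlice P A i (sl i))
    (hi : Improves A sl ρ S S') (hr : IsReducedValue P A sl S' ρ ρ') :
    Visited P A sl (insert S' V) S' ρ' := by
  have hinv := h.inv.improve h.top hsl hi
  have hsub : ∀ S₀ ∈ V, support S₀ ⊆ support S' := fun S₀ hS₀ k hk =>
    mem_support.2 (hi.ne_none (mem_support.1 (h.support_subset S₀ hS₀ hk)))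
  have hle := hinv.le_of_isTop (hinv.isTop_reduced hr)
  refine ⟨hinv.reduced hsl hr, hinv.isTop_reduced hr, Finset.mem_insert_self _ _, ?_, ?_, ?_⟩
  · intro S₁ h₁ S₂ h₂
    rcases Finset.mem_insert.1 h₁ with rfl | h₁'
    · rcases Finset.mem_insert.1 h₂ with rfl | h₂
      · exact Or.inl le_rfl
      · exact Or.inr (hsub S₂ h₂)
    · rcases Finset.mem_insert.1 h₂ with rfl | h₂
      · exact Or.inl (hsub S₁ h₁')
      · exact h.chain S₁ h₁' S₂ h₂
  · intro S₀ h₀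
    rcases Finset.mem_insert.1 h₀ with rfl | h₀
    · exact le_rfl
    · exact hsub S₀ h₀
  · intro S₀ h₀
    rcases Finset.mem_insert.1 h₀ with rfl | h₀
    · exact ⟨ρ', le_rfl, hinv.isTop_reduced hr⟩
    · obtain ⟨ρ₀, hρ₀, ht₀⟩ := h.value_le S₀ h₀
      exact ⟨ρ₀, hρ₀.trans hle, ht₀⟩

end Round

/-! ### The original iteration -/

/-- Annotation of the configurations of the original iteration by the visited strategies. -/
def OrigAnnot (P : Program n m d E) (A : Matrix (Fin l) (Fin m) ℚ)
    (V : Finset (Strategy n d l)) : OrigConf n d l → Prop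
  | .run S ρ => Visited P A (fun _ => P.T) V S ρ
  | .halt ρ => ∃ S, Visited P A (fun _ => P.T) V S ρ ∧ ¬ Violable A (fun _ => P.T) ρ

/-- A bound on the number of steps left. -/
def origMeasure (V : Finset (Strategy n d l)) : OrigConf n d l → ℕ
  | .run _ _ => Fintype.card (Strategy n d l) - V.card + 1
  | .halt _ => 0

theorem card_sub_insert_lt {V : Finset (Strategy n d l)} {S : Strategy n d l} (h : S ∉ V) :
    Fintype.card (Strategy n d l) - (insert S V).card <
      Fintype.card (Strategy n d l) - V.card := by
  have h1 := Finset.card_insert_of_notMem h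
  have h2 := Finset.card_le_univ (insert S V)
  omega

theorem exists_improves (A : Matrix (Fin l) (Fin m) ℚ) (sl : Fin l → Formula n m d E)
    (ρ : AbsVal n l) (S : Strategy n d l) : ∃ S', Improves A sl ρ S S' := by
  have : ∀ i b', ∃ q, (∃ b x x' p y, Violates A (sl i) ρ i b x b' x' p y ∧ q = some (b, p)) ∨
      ((¬ ∃ b x x' p y, Violates A (sl i) ρ i b x b' x' p y) ∧ q = S i b') := by
    intro i b'
    by_cases h : ∃ b x x' p y, Violates A (sl i) ρ i b x b' x' p y
    · obtain ⟨b, x, x', p, y, hv⟩ := h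
      exact ⟨some (b, p), Or.inl ⟨b, x, x', p, y, hv, rfl⟩⟩
    · exact ⟨S i b', Or.inr ⟨h, rfl⟩⟩
  choose S' hS' using this
  exact ⟨S', hS'⟩

theorem orig_step {V : Finset (Strategy n d l)} {c c' : OrigConf n d l}
    (h : OrigAnnot P A V c) (hs : OrigStep P A c c') :
    ∃ V', OrigAnnot P A V' c' ∧ origMeasure V' c' < origMeasure V c := by
  cases hs with
  | exit S ρ hv => exact ⟨V, ⟨S, h, hv⟩, Nat.succ_pos _⟩
  | improve S S' ρ ρ' hv hi hρ' =>
    have hsl : ∀ i : Fin l, IsSlice P A i ((fun _ => P.T) i) := isSlice_self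
    have h : Visited P A (fun _ => P.T) V S ρ := h
    have hinv := h.inv.improve h.top hsl hi
    obtain ⟨ρ'', hr⟩ := hinv.exists_isReducedValue
    -- Least fixed points are unique, so the value taken by the step is the one computed by the
    -- linear program, to which the invariants apply.
    obtain rfl := (hinv.isStrategyValue hr).unique hρ'
    exact ⟨_, h.insert hsl hi hr,
      Nat.succ_lt_succ (card_sub_insert_lt (h.notMem_of_improves hsl hi hv))⟩

theorem orig_progress {V : Finset (Strategy n d l)} {c : OrigConf n d l}
    (h : OrigAnnot P A V c) : c ∈ {c | ∃ ρ, c = .halt ρ} ∨ ∃ c', OrigStep P A c c' := by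
  rcases c with ⟨S, ρ⟩ | ρ
  · right
    have h : Visited P A (fun _ => P.T) V S ρ := h
    by_cases hv : HasViolation P A ρ
    · obtain ⟨S', hi⟩ := exists_improves A (fun _ => P.T) ρ S
      have hinv := h.inv.improve h.top isSlice_self hi
      obtain ⟨ρ', hr⟩ := hinv.exists_isReducedValue
      exact ⟨_, .improve S S' ρ ρ' hv hi (hinv.isStrategyValue hr)⟩
    · exact ⟨_, .exit S ρ hv⟩
  · exact Or.inl ⟨ρ, rfl⟩

theorem orig_terminates (P : Program n m d E) (A : Matrix (Fin l) (Fin m) ℚ) :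
    Terminates (OrigStep P A) {c | ∃ ρ, c = .halt ρ} (origInit P A) ∧
      ∀ c, Relation.ReflTransGen (OrigStep P A) (origInit P A) c → ∃ V, OrigAnnot P A V c :=
  terminates_of_measure (OrigAnnot P A) origMeasure (fun _ _ _ => orig_step)
    (fun _ _ => orig_progress) (v₀ := {botStrategy n d l}) visited_init

/-! ### The algorithm Iterate -/

/-- What Improve has achieved for the rows before `i` and, in row `i`, for the states in `U`. -/
structure Progress (A : Matrix (Fin l) (Fin m) ℚ) (sl : Fin l → Formula n m d E)
    (S S' : Strategy n d l) (ρ : AbsVal n l) (st : Bool) (i : ℕ) (U : Set (BState n)) :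
    Prop where
  le : i ≤ l
  before : ∀ j : Fin l, (j : ℕ) < i → ∀ b',
    (∃ b x x' p y, Violates A (sl j) ρ j b x b' x' p y ∧ S' j b' = some (b, p)) ∨
    ((¬ ∃ b x x' p y, Violates A (sl j) ρ j b x b' x' p y) ∧ S' j b' = S j b')
  current : ∀ j : Fin l, (j : ℕ) = i → ∀ b' ∈ U,
    ∃ b x x' p y, Violates A (sl j) ρ j b x b' x' p y ∧ S' j b' = some (b, p)
  rest : ∀ j : Fin l, ∀ b', (j : ℕ) > i ∨ (j : ℕ) = i ∧ b' ∉ U → S' j b' = S j b'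
  changed : st = false → Violable A sl ρ
  unchanged : st = true → U = ∅ ∧ ∀ j : Fin l, (j : ℕ) < i →
    ¬ ∃ b x b' x' p y, Violates A (sl j) ρ j b x b' x' p y

/-- Annotation of the configurations of Iterate by the visited strategies. -/
def Annot (P : Program n m d E) (A : Matrix (Fin l) (Fin m) ℚ) (sl : Fin l → Formula n m d E)
    (V : Finset (Strategy n d l)) : Conf n d l → Prop
  | .head S ρ st => Visited P A sl V S ρ ∧ (st = true → ¬ Violable A sl ρ)
  | .outer S' ρ st i U => ∃ S, Visited P A sl V S ρ ∧ Progress A sl S S' ρ st i U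
  | .inner S' ρ st i U F => ∃ S, Visited P A sl V S ρ ∧ Progress A sl S S' ρ st i U ∧
      st = false ∧ ∃ hi : i < l, ∀ t ∈ F, t.2.1 ∉ U ∧
        ∃ x x' y, Violates A (sl ⟨i, hi⟩) ρ ⟨i, hi⟩ t.1 x t.2.1 x' t.2.2 y
  | .eval S' ρ => ∃ S, Visited P A sl V S ρ ∧ Improves A sl ρ S S' ∧ Violable A sl ρ
  | .halt ρ => ∃ S, Visited P A sl V S ρ ∧ ¬ Violable A sl ρ

/-- The number of rows and arrival states that Improve can still treat. -/
noncomputable def pending (n l i : ℕ) (U : Set (BState n)) : ℕ :=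
  -- Resetting `U` to `∅` in the next row gains at most the number of states, one less than the
  -- weight of a row.
  (l - i) * (Fintype.card (BState n) + 1) + Uᶜ.ncard

open Classical in
/-- A bound on the number of steps up to the end of the current iteration of the main loop. -/
noncomputable def phase : Conf n d l → ℕ
  | .head _ _ false => pending n l 0 ∅ * 3 + 4
  | .head _ _ true => 1
  | .outer _ _ _ i U => pending n l i U * 3 + 3
  -- The extra `2` pays for leaving the inner loop once `F` is empty. An assignment lowers
  -- `pending`, hence the product by at least `3`, which covers this extra.
  | .inner _ _ _ i U F => pending n l i U * 3 + 2 + if F = ∅ then 2 else 0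
  | .eval _ _ => 0
  | .halt _ => 0

theorem pending_next {i : ℕ} (hi : i < l) (U : Set (BState n)) :
    pending n l (i + 1) ∅ < pending n l i U := by
  have h1 : l - i = l - (i + 1) + 1 := by omega
  simp only [pending, Set.compl_empty, Set.ncard_univ, Nat.card_eq_fintype_card]
  rw [h1, add_mul]
  omega

theorem pending_union (i : ℕ) {U G : Set (BState n)} {b : BState n} (hb : b ∉ U) (hG : b ∈ G) :
    pending n l i (U ∪ G) < pending n l i U := by
  refine Nat.add_lt_add_left (Set.ncard_lt_ncard ?_ (Set.toFinite _)) _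
  refine ⟨Set.compl_subset_compl.2 Set.subset_union_left, fun h => ?_⟩
  exact h hb (Or.inr hG)

section Steps
variable {V : Finset (Strategy n d l)} {S S' : Strategy n d l} {ρ : AbsVal n l} {st : Bool} {i : ℕ}
  {U : Set (BState n)}

theorem Progress.improves (h : Progress A sl S S' ρ st l U) : Improves A sl ρ S S' :=
  fun j b' => h.before j j.2 b'

theorem Progress.start : Progress A sl S S ρ true 0 ∅ where
  le := Nat.zero_le _
  before _ hj := absurd hj (Nat.not_lt_zero _)
  current _ _ _ hb := absurd hb (Set.notMem_empty _)
  rest _ _ _ := rfl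
  changed h := by simp at h
  unchanged _ := ⟨rfl, fun _ hj => absurd hj (Nat.not_lt_zero _)⟩

theorem Progress.violated (h : Progress A sl S S' ρ st i U) (hv : Violable A sl ρ) :
    Progress A sl S S' ρ false i U :=
  ⟨h.le, h.before, h.current, h.rest, fun _ => hv, fun h' => by simp at h'⟩

theorem Progress.nextRow (h : Progress A sl S S' ρ st i U) (hi : i < l)
    (hn : ¬ ∃ b x b' x' p y, Violates A (sl ⟨i, hi⟩) ρ ⟨i, hi⟩ b x b' x' p y ∧ b' ∉ U) :
    Progress A sl S S' ρ st (i + 1) ∅ where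
  le := hi
  before j hj b' := by
    rcases Nat.lt_succ_iff_lt_or_eq.1 hj with hlt | heq
    · exact h.before j hlt b'
    · by_cases hb : b' ∈ U
      · exact Or.inl (h.current j heq b' hb)
      · obtain rfl : j = ⟨i, hi⟩ := Fin.ext heq
        refine Or.inr ⟨?_, h.rest _ b' (Or.inr ⟨heq, hb⟩)⟩
        rintro ⟨b, x, x', p, y, hv⟩
        exact hn ⟨b, x, b', x', p, y, hv, hb⟩
  current _ _ _ hb := absurd hb (Set.notMem_empty _)
  rest j b' hj := h.rest j b' (Or.inl (by omega))
  changed := h.changed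
  unchanged hst := by
    obtain ⟨hU, hrows⟩ := h.unchanged hst
    refine ⟨rfl, fun j hj => ?_⟩
    rcases Nat.lt_succ_iff_lt_or_eq.1 hj with hlt | heq
    · exact hrows j hlt
    · obtain rfl : j = ⟨i, hi⟩ := Fin.ext heq
      rintro ⟨b, x, b', x', p, y, hv⟩
      exact hn ⟨b, x, b', x', p, y, hv, by simp [hU]⟩

theorem Progress.assign (h : Progress A sl S S' ρ st i U) (hst : st = false) (hi : i < l)
    {G : Set (BState n)} {b : BState n} {p : Path d}
    (hG : ∀ b' ∈ G, ∃ x x' y, Violates A (sl ⟨i, hi⟩) ρ ⟨i, hi⟩ b x b' x' p y) :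
    Progress A sl S (update S' ⟨i, hi⟩ G b p) ρ st i (U ∪ G) where
  le := h.le
  before j hj b' := by
    have hne : j ≠ ⟨i, hi⟩ := fun he => by simp [he] at hj
    simpa [update, hne] using h.before j hj b'
  current j hj b' hb := by
    obtain rfl : j = ⟨i, hi⟩ := Fin.ext hj
    by_cases hbG : b' ∈ G
    · obtain ⟨x, x', y, hv⟩ := hG b' hbG
      exact ⟨b, x, x', p, y, hv, by simp [update, hbG]⟩
    · simpa [update, hbG] using h.current _ hj b' (hb.resolve_right hbG)
  rest j b' hj := by
    have hcond : ¬ (j = ⟨i, hi⟩ ∧ b' ∈ G) := by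
      rintro ⟨rfl, hbG⟩
      rcases hj with hj | ⟨-, hb⟩
      · exact lt_irrefl _ hj
      · exact hb (Or.inr hbG)
    simp only [update, if_neg hcond]
    exact h.rest j b' (hj.imp_right fun hj => ⟨hj.1, fun hb => hj.2 (Or.inl hb)⟩)
  changed := h.changed
  unchanged h' := by simp [hst] at h'

/-- A step stays within an iteration of the main loop, or it evaluates a new strategy and begins
the next iteration. -/
theorem annot_step (hsl : ∀ i, IsSlice P A i (sl i)) {c c' : Conf n d l}
    (h : Annot P A sl V c) (hs : Step P A sl c c') :
    (Annot P A sl V c' ∧ phase c' < phase c ∧ c' ∉ iterationStarts n d l ∧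
      c ∉ fullEvaluations n d l) ∨
    ∃ S ρ ρ', c = .eval S ρ ∧ c' = .head S ρ' false ∧ S ∉ V ∧ Annot P A sl (insert S V) c' := by
  cases hs with
  | enter S ρ =>
    exact Or.inl ⟨⟨S, h.1, .start⟩, Nat.lt_succ_self _, by simp [iterationStarts],
      by simp [fullEvaluations]⟩
  | exit S ρ =>
    exact Or.inl ⟨⟨S, h.1, h.2 rfl⟩, Nat.one_pos, by simp [iterationStarts],
      by simp [fullEvaluations]⟩
  | model S ρ st i hi U b x b' x' p y hv hU =>
    obtain ⟨S₀, hV, hp⟩ := h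
    refine Or.inl ⟨⟨S₀, hV, hp.violated ⟨_, b, x, b', x', p, y, hv⟩, rfl, hi, ?_⟩, ?_,
      by simp [iterationStarts], by simp [fullEvaluations]⟩
    · exact fun t ht => ⟨ht.2, x, x', y, ht.1⟩
    · have hne : generalize A (sl ⟨i, hi⟩) ρ ⟨i, hi⟩ U x x' y ≠ ∅ :=
        Set.nonempty_iff_ne_empty.1 ⟨(b, b', p), hv, hU⟩
      simp [phase, hne]
  | nextRow S ρ st i hi U hn =>
    obtain ⟨S₀, hV, hp⟩ := h
    refine Or.inl ⟨⟨S₀, hV, hp.nextRow hi hn⟩, ?_, by simp [iterationStarts],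
      by simp [fullEvaluations]⟩
    have := pending_next hi U
    simp only [phase]
    omega
  | assign S ρ st i hi U F b b' p hF =>
    obtain ⟨S₀, hV, hp, hst, hi', hall⟩ := h
    refine Or.inl ⟨⟨S₀, hV, hp.assign hst hi fun b₁ hb₁ => (hall _ hb₁).2, hst, hi, ?_⟩, ?_,
      by simp [iterationStarts], by simp [fullEvaluations]⟩
    · rintro t ⟨ht, htG⟩
      refine ⟨fun hU => hU.elim (hall t ht).1 htG, (hall t ht).2⟩
    · have h1 := pending_union (l := l) i (hall _ hF).1 (show b' ∈ slab F b p from hF)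
      have hne : F ≠ ∅ := Set.nonempty_iff_ne_empty.1 ⟨_, hF⟩
      simp only [phase, if_neg hne]
      split <;> omega
  | innerEnd S ρ st i U F hF =>
    obtain ⟨S₀, hV, hp, -⟩ := h
    exact Or.inl ⟨⟨S₀, hV, hp⟩, by simp [phase, hF], by simp [iterationStarts],
      by simp [fullEvaluations]⟩
  | isStable S ρ U =>
    obtain ⟨S₀, hV, hp⟩ := h
    have hn : ¬ Violable A sl ρ := by
      rintro ⟨j, hv⟩
      exact (hp.unchanged rfl).2 j j.2 hv
    -- Without violations nothing was reassigned, so the strategy is the one evaluated last.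
    have hS : S = S₀ := by
      ext1 j
      ext1 b'
      rcases hp.improves j b' with ⟨b, x, x', p, y, hv, -⟩ | ⟨-, he⟩
      · exact absurd ⟨j, b, x, b', x', p, y, hv⟩ hn
      · exact he
    subst hS
    exact Or.inl ⟨⟨hV, fun _ => hn⟩, by simp [phase], by simp [iterationStarts],
      by simp [fullEvaluations]⟩
  | notStable S ρ U =>
    obtain ⟨S₀, hV, hp⟩ := h
    exact Or.inl ⟨⟨S₀, hV, hp.improves, hp.changed rfl⟩, by simp [phase],
      by simp [iterationStarts], by simp [fullEvaluations]⟩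
  | value S ρ ρ' hr =>
    obtain ⟨S₀, hV, hi, hv⟩ := h
    exact Or.inr ⟨S, ρ, ρ', rfl, rfl, hV.notMem_of_improves hsl hi hv,
      hV.insert hsl hi hr, fun h' => by simp at h'⟩

theorem annot_progress (hsl : ∀ i, IsSlice P A i (sl i)) {c : Conf n d l}
    (h : Annot P A sl V c) : c ∈ {c | ∃ ρ, c = .halt ρ} ∨ ∃ c', Step P A sl c c' := by
  rcases c with ⟨S, ρ, st⟩ | ⟨S, ρ, st, i, U⟩ | ⟨S, ρ, st, i, U, F⟩ | ⟨S, ρ⟩ | ρ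
  · cases st
    · exact Or.inr ⟨_, .enter S ρ⟩
    · exact Or.inr ⟨_, .exit S ρ⟩
  · right
    obtain ⟨S₀, hV, hp⟩ := h
    rcases hp.le.lt_or_eq with hi | rfl
    · by_cases hv : ∃ b x b' x' p y, Violates A (sl ⟨i, hi⟩) ρ ⟨i, hi⟩ b x b' x' p y ∧ b' ∉ U
      · obtain ⟨b, x, b', x', p, y, hv, hU⟩ := hv
        exact ⟨_, .model S ρ st i hi U b x b' x' p y hv hU⟩
      · exact ⟨_, .nextRow S ρ st i hi U hv⟩
    · cases st
      · exact ⟨_, .notStable S ρ U⟩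
      · exact ⟨_, .isStable S ρ U⟩
  · right
    obtain ⟨S₀, hV, hp, hst, hi, hall⟩ := h
    rcases F.eq_empty_or_nonempty with hF | ⟨⟨b, b', p⟩, hF⟩
    · exact ⟨_, .innerEnd S ρ st i U F hF⟩
    · exact ⟨_, .assign S ρ st i hi U F b b' p hF⟩
  · right
    obtain ⟨S₀, hV, hi, hv⟩ := h
    obtain ⟨ρ', hr⟩ := (hV.inv.improve hV.top hsl hi).exists_isReducedValue
    exact ⟨_, .value S ρ ρ' hr⟩
  · exact Or.inl ⟨ρ, rfl⟩

end Steps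

/-! ### Termination and counting for executions of Iterate -/

theorem phase_lt (c : Conf n d l) (hc : c ∈ iterationStarts n d l) :
    phase c < pending n l 0 ∅ * 3 + 5 := by
  obtain ⟨S, ρ, rfl⟩ := hc
  exact Nat.lt_succ_self _

theorem annot_init : Annot P A sl {botStrategy n d l} (iterInit P A) :=
  ⟨visited_init, fun h => by simp at h⟩

theorem iterate_terminates (hsl : ∀ i, IsSlice P A i (sl i)) :
    Terminates (Step P A sl) {c | ∃ ρ, c = .halt ρ} (iterInit P A) ∧
      ∀ c, Relation.ReflTransGen (Step P A sl) (iterInit P A) c → ∃ V, Annot P A sl V c := by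
  refine terminates_of_measure (Annot P A sl)
    (fun V c => (Fintype.card (Strategy n d l) - V.card) * (pending n l 0 ∅ * 3 + 5) + phase c)
    (fun V c c' h hs => ?_) (fun _ _ h => annot_progress hsl h) annot_init
  rcases annot_step hsl h hs with ⟨h', hlt, -⟩ | ⟨S, ρ, ρ', rfl, rfl, hS, h'⟩
  · exact ⟨V, h', Nat.add_lt_add_left hlt _⟩
  · refine ⟨_, h', ?_⟩
    have h1 := phase_lt (.head S ρ' false : Conf n d l) ⟨S, ρ', rfl⟩
    have h2 := Nat.mul_le_mul_right (pending n l 0 ∅ * 3 + 5)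
      (Nat.succ_le_of_lt (card_sub_insert_lt hS))
    rw [Nat.succ_mul] at h2
    omega

/-- The number of iterations begun so far is bounded by the number of visited strategies. -/
theorem reaches_iterationStarts (hsl : ∀ i, IsSlice P A i (sl i)) {k : ℕ} {c : Conf n d l}
    (h : Reaches (Step P A sl) (iterationStarts n d l) (iterInit P A) k c) :
    ∃ V, Annot P A sl V c ∧ k ≤ V.card ∧ (c ∈ iterationStarts n d l → k + 1 ≤ V.card) := by
  have key : ∀ {V : Finset (Strategy n d l)} {c c' : Conf n d l} {k : ℕ}, Annot P A sl V c →
      Step P A sl c c' → k ≤ V.card → ∃ V', Annot P A sl V' c' ∧ k ≤ V'.card ∧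
        (c' ∈ iterationStarts n d l → k + 1 ≤ V'.card) := by
    intro V c c' k h hs hk
    rcases annot_step hsl h hs with ⟨h', -, hc', -⟩ | ⟨S, ρ, ρ', rfl, rfl, hS, h'⟩
    · exact ⟨V, h', hk, fun hc => absurd hc hc'⟩
    · have := Finset.card_insert_of_notMem hS
      exact ⟨_, h', by omega, fun _ => by omega⟩
  induction h with
  -- The strategy `⊥` counts as visited from the start; it pays for the first iteration.
  | refl => exact ⟨_, annot_init, Nat.zero_le _, fun _ => by simp⟩
  | count k c c' _ hs hM ih =>
    obtain ⟨V, hV, -, hk⟩ := ih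
    exact key hV hs (hk hM)
  | skip k c c' _ hs hM ih =>
    obtain ⟨V, hV, hk, -⟩ := ih
    exact key hV hs hk

/-- The number of evaluations of full strategies is bounded by the number of full strategies that
have been visited. -/
theorem reaches_fullEvaluations (hsl : ∀ i, IsSlice P A i (sl i)) {k : ℕ} {c : Conf n d l}
    (h : Reaches (Step P A sl) (fullEvaluations n d l) (iterInit P A) k c) :
    ∃ V, Annot P A sl V c ∧ k ≤ (fullStrategies V).card := by
  induction h with
  | refl => exact ⟨_, annot_init, Nat.zero_le _⟩
  | count k c c' _ hs hM ih =>
    obtain ⟨V, hV, hk⟩ := ih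
    rcases annot_step hsl hV hs with ⟨-, -, -, hc⟩ | ⟨S, ρ, ρ', rfl, rfl, hS, h'⟩
    · exact absurd hM hc
    · refine ⟨_, h', ?_⟩
      obtain ⟨S₁, ρ₁, he, hfull⟩ := hM
      cases he
      rw [fullStrategies, Finset.filter_insert, if_pos hfull,
        Finset.card_insert_of_notMem fun hmem => hS (Finset.mem_filter.1 hmem).1]
      exact Nat.succ_le_succ hk
  | skip k c c' _ hs hM ih =>
    obtain ⟨V, hV, hk⟩ := ih
    rcases annot_step hsl hV hs with ⟨h', -⟩ | ⟨S, ρ, ρ', rfl, rfl, hS, h'⟩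
    · exact ⟨V, h', hk⟩
    · exact ⟨_, h', hk.trans (Finset.card_le_card
        (Finset.filter_subset_filter _ (Finset.subset_insert _ _)))⟩

theorem Annot.exists_visited {V : Finset (Strategy n d l)} {c : Conf n d l}
    (h : Annot P A sl V c) : ∃ S ρ, Visited P A sl V S ρ := by
  rcases c with ⟨S, ρ, st⟩ | ⟨S, ρ, st, i, U⟩ | ⟨S, ρ, st, i, U, F⟩ | ⟨S, ρ⟩ | ρ
  · exact ⟨S, ρ, h.1⟩
  all_goals
    obtain ⟨S₀, hV, -⟩ := h
    exact ⟨S₀, ρ, hV⟩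

end Execution

end StratIter

theorem mainTheorem1 {n m d E l : ℕ} (P : StratIter.Program n m d E)
    (A : Matrix (Fin l) (Fin m) ℚ) (sl : Fin l → StratIter.Formula n m d E)
    (hsl : ∀ i, StratIter.IsSlice P A i (sl i)) :
    StratIter.Terminates (StratIter.Step P A sl) {c | ∃ ρ, c = .halt ρ} (StratIter.iterInit P A) ∧
    (∀ k c, StratIter.Reaches (StratIter.Step P A sl) (StratIter.iterationStarts n d l)
        (StratIter.iterInit P A) k c →
      k ≤ ∑ j ∈ Finset.range (l * 2 ^ n + 1), 2 ^ ((n + d) * j)) ∧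
    (∀ k c, StratIter.Reaches (StratIter.Step P A sl) (StratIter.fullEvaluations n d l)
        (StratIter.iterInit P A) k c →
      k ≤ 2 ^ ((n + d) * l * 2 ^ n)) ∧
    StratIter.Terminates (StratIter.OrigStep P A) {c | ∃ ρ, c = .halt ρ}
      (StratIter.origInit P A) ∧
    ∃ ρ : StratIter.AbsVal n l,
      IsLeast {η | StratIter.IsInductive P A η} ρ ∧
      (∀ ρ', Relation.ReflTransGen (StratIter.Step P A sl) (StratIter.iterInit P A) (.halt ρ') →
        ρ' = ρ) ∧
      (∀ ρ', Relation.ReflTransGen (StratIter.OrigStep P A) (StratIter.origInit P A) (.halt ρ') →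
        ρ' = ρ) := by
  obtain ⟨hterm, hannot⟩ := StratIter.iterate_terminates hsl
  obtain ⟨hterm₀, hannot₀⟩ := StratIter.orig_terminates P A
  have hleast : ∀ ρ', Relation.ReflTransGen (StratIter.Step P A sl) (StratIter.iterInit P A)
      (.halt ρ') → IsLeast {η | StratIter.IsInductive P A η} ρ' := by
    intro ρ' h
    obtain ⟨V, S, hV, hv⟩ := hannot _ h
    exact hV.inv.isLeast hsl hv
  have hleast₀ : ∀ ρ', Relation.ReflTransGen (StratIter.OrigStep P A) (StratIter.origInit P A)
      (.halt ρ') → IsLeast {η | StratIter.IsInductive P A η} ρ' := by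
    intro ρ' h
    obtain ⟨V, S, hV, hv⟩ := hannot₀ _ h
    exact hV.inv.isLeast StratIter.isSlice_self hv
  refine ⟨hterm, fun k c h => ?_, fun k c h => ?_, hterm₀, ?_⟩
  · obtain ⟨V, hV, hk, -⟩ := StratIter.reaches_iterationStarts hsl h
    obtain ⟨S, ρ, hvis⟩ := hV.exists_visited
    exact hk.trans (StratIter.card_le_of_chain hvis.chain)
  · obtain ⟨V, -, hk⟩ := StratIter.reaches_fullEvaluations hsl h
    exact hk.trans (StratIter.card_fullStrategies_le V)
  -- The existence of a least inductive invariant comes from termination: some halting configuration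
  -- is reached.
  · obtain ⟨_, ⟨ρ, rfl⟩, hρ⟩ := hterm.exists_reachable
    exact ⟨ρ, hleast ρ hρ, fun ρ' h => (hleast ρ' h).unique (hleast ρ hρ),
      fun ρ' h => (hleast₀ ρ' h).unique (hleast ρ hρ)⟩
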